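/- For real $s,t,x,y$ let $$K_{s,t}(x,y)=-\frac1{4\pi^2}\int_X dV\int_{-i\infty}^{i\infty}dU\,\frac{e^{-U^4/4+tU^2/2-Uy}\,e^{V^4/4-sV^2/2+Vx}}{U-V}-\frac{\mathbb I(s<t)}{\sqrt{2\pi(t-s)}}\,e^{-\frac{(x-y)^2}{2(t-s)}}$$ be the Pearcey kernel, where $X$ consists of the ingoing rays from $\pm\infty e^{i\pi/4}$ to $0$ and the outgoing rays from $0$ to $\pm\infty e^{-i\pi/4}$. For $r\ge 1$ and $y_1<\dots<y_{2r}$ put $E=\bigcup_{i=1}^r(y_{2i-1},y_{2i})$ and let $$\mathbb P^{\mathcal P}(t,E)=\det\bigl(I-K_{t,t}\chi_E\bigr)=\sum_{n\ge0}\frac{(-1)^n}{n!}\int_{E^n}\det\bigl(K_{t,t}(x_i,x_j)\bigr)_{1\le i,j\le n}\,dx_1\cdots dx_n$$ be the probability that the Pearcey process at time $t$ has no particle in $E$. Let $\partial_E=\sum_{i=1}^{2r}\partial/\partial y_i$ and $\{f,g\}_{\partial_E}=g\,\partial_Ef-f\,\partial_Eg$. Then, for every $r\ge1$, the Wronskian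 $$\Bigl\{\frac{\partial}{\partial t}\,\partial_E^2\log\mathbb P^{\mathcal P},\ \partial_E^3\log\mathbb P^{\mathcal P}\Bigr\}_{\partial_E},$$ as a function of $t$ and of $y_1<\dots<y_{2r}$, is not identically zero: there are $t\in\mathbb R$ and $y_1<\dots<y_{2r}$ such that $\mathbb P^{\mathcal P}(t,E)>0$, the function $\log\mathbb P^{\mathcal P}$ is of class $C^4$ near $(t,y_1,\dots,y_{2r})$, and the Wronskian is nonzero at this point. -/

import Mathlib

open MeasureTheory

/-- The unit vector `e^{iπ/4}`. -/
noncomputable def pearceyOmega : ℂ := Complex.exp ((Real.pi / 4 : ℝ) * Complex.I)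

/-- The contour integral `∫_X f(V) dV`, where `X` consists of the two ingoing rays from
`±∞ e^{iπ/4}` to `0` and of the two outgoing rays from `0` to `±∞ e^{-iπ/4}`. -/
noncomputable def integralX (f : ℂ → ℂ) : ℂ :=
  -(∫ ρ in Set.Ioi (0 : ℝ), f (ρ * pearceyOmega) * pearceyOmega)
    - (∫ ρ in Set.Ioi (0 : ℝ), f (ρ * -pearceyOmega) * -pearceyOmega)
    + (∫ ρ in Set.Ioi (0 : ℝ), f (ρ * (starRingEnd ℂ) pearceyOmega) * (starRingEnd ℂ) pearceyOmega)
    + (∫ ρ in Set.Ioi (0 : ℝ),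
        f (ρ * -(starRingEnd ℂ) pearceyOmega) * -(starRingEnd ℂ) pearceyOmega)

/-- The contour integral `∫_{-i∞}^{i∞} g(U) dU` along the imaginary axis. -/
noncomputable def integralIm (g : ℂ → ℂ) : ℂ :=
  ∫ u : ℝ, g (u * Complex.I) * Complex.I

/-- The integrand of the double contour integral in the Pearcey kernel. -/
noncomputable def pearceyIntegrand (s t x y : ℝ) (V U : ℂ) : ℂ :=
  Complex.exp (-(U ^ 4 / 4) + t * U ^ 2 / 2 - U * y)
    * Complex.exp (V ^ 4 / 4 - s * V ^ 2 / 2 + V * x) * (1 / (U - V))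

/-- The double contour integral
`-1/(4π²) ∫_X dV ∫_{-i∞}^{i∞} dU e^{-U⁴/4+tU²/2-Uy} e^{V⁴/4-sV²/2+Vx} / (U-V)`. -/
noncomputable def pearceyContour (s t x y : ℝ) : ℂ :=
  -(1 / (4 * (Real.pi : ℂ) ^ 2)) *
    integralX (fun V => integralIm (fun U => pearceyIntegrand s t x y V U))

/-- The (extended) Pearcey kernel `K_{s,t}(x,y)`; the double integral is a real number by
`pearceyContour_im`, so that taking the real part loses nothing. -/
noncomputable def pearceyKernel (s t x y : ℝ) : ℝ :=
  (pearceyContour s t x y).re -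
    if s < t then
      1 / Real.sqrt (2 * Real.pi * (t - s)) * Real.exp (-((x - y) ^ 2 / (2 * (t - s))))
    else 0

theorem conj_integralX (f : ℂ → ℂ) :
    (starRingEnd ℂ) (integralX f) =
      -integralX (fun V => (starRingEnd ℂ) (f ((starRingEnd ℂ) V))) := by
  simp only [integralX, map_add, map_sub, map_neg, ← integral_conj, map_mul, Complex.conj_conj,
    Complex.conj_ofReal]
  ring

theorem conj_integralIm (g : ℂ → ℂ) :
    (starRingEnd ℂ) (integralIm g) =
      -integralIm (fun U => (starRingEnd ℂ) (g ((starRingEnd ℂ) U))) := by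
  have h := integral_neg_eq_self
    (fun u : ℝ => (starRingEnd ℂ) (g (u * Complex.I)) * Complex.I) volume
  simp only [Complex.ofReal_neg, neg_mul] at h
  simp only [integralIm, ← integral_conj, map_mul, Complex.conj_I, Complex.conj_ofReal, mul_neg,
    integral_neg, h]

theorem pearceyContour_im (s t x y : ℝ) : (pearceyContour s t x y).im = 0 := by
  rw [← Complex.conj_eq_iff_im]
  simp only [pearceyContour, map_mul, conj_integralX, conj_integralIm, pearceyIntegrand,
    ← Complex.exp_conj, map_add, map_sub, map_neg, map_div₀, map_pow, Complex.conj_conj,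
    Complex.conj_ofReal, map_one, map_ofNat]
  simp only [integralX, integral_neg, neg_mul]
  ring

/-- The Fredholm determinant `det (I - K χ_E)`, as Fredholm's series
`∑ₙ (-1)ⁿ/n! ∫_{Eⁿ} det (K(xᵢ,xⱼ)) dx₁ ⋯ dxₙ`. -/
noncomputable def fredholmDet (K : ℝ → ℝ → ℝ) (E : Set ℝ) : ℝ :=
  ∑' n : ℕ, (-1 : ℝ) ^ n / (n.factorial : ℝ) *
    ∫ x in Set.univ.pi (fun _ : Fin n => E), (Matrix.of fun i j => K (x i) (x j)).det

/-- The set `E = ⋃ᵢ (y_{2i-1}, y_{2i})`, `1 ≤ i ≤ r`, with boundary points `y₁, …, y_{2r}`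
(indexed from `0` here). -/
def intervalUnion {r : ℕ} (y : Fin (2 * r) → ℝ) : Set ℝ :=
  ⋃ i : Fin r, Set.Ioo (y ⟨2 * i.val, by omega⟩) (y ⟨2 * i.val + 1, by omega⟩)

/-- The probability that the Pearcey process at time `t` has no particle in the union of
intervals with boundary points `y`: the Fredholm determinant of the Pearcey kernel `K_{t,t}`. -/
noncomputable def pearceyProb {r : ℕ} (t : ℝ) (y : Fin (2 * r) → ℝ) : ℝ :=
  fredholmDet (pearceyKernel t t) (intervalUnion y)

/-- The operator `∂_E = ∑ᵢ ∂/∂yᵢ` on functions of `t` and of the boundary points. -/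
noncomputable def boundaryDeriv {m : ℕ} (f : ℝ → (Fin m → ℝ) → ℝ) (t : ℝ) (y : Fin m → ℝ) : ℝ :=
  ∑ i, deriv (fun s => f t (Function.update y i s)) (y i)

/-- The operator `∂/∂t` on functions of `t` and of the boundary points. -/
noncomputable def timeDeriv {m : ℕ} (f : ℝ → (Fin m → ℝ) → ℝ) (t : ℝ) (y : Fin m → ℝ) : ℝ :=
  deriv (fun s => f s y) t

/-- The Wronskian `{f, g}_{∂_E} = g ∂_E f - f ∂_E g`. -/
noncomputable def boundaryWronskian {m : ℕ} (f g : ℝ → (Fin m → ℝ) → ℝ)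
    (t : ℝ) (y : Fin m → ℝ) : ℝ :=
  g t y * boundaryDeriv f t y - f t y * boundaryDeriv g t y

/-- `log ℙ` as a function of `t` and of the `2r` boundary points of `E`. -/
noncomputable def logPearcey (r : ℕ) (t : ℝ) (y : Fin (2 * r) → ℝ) : ℝ :=
  Real.log (pearceyProb t y)

/-! Let all endpoints collapse. Pulled back to a fixed compact parameter space, with the interval
lengths as Jacobian, the kernel depends smoothly on `(t, y)` and vanishes when all `y_i` coincide.
The Fredholm determinant is analytic near the zero kernel, with value `1` and derivative minus the
trace. Hence `log ℙ` agrees, for ordered endpoints, with a function `L` that is smooth near the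
origin, vanishes on the diagonal `(t, h, …, h)`, and has there the derivative `-r ρ(t, h)` in the
direction `a` of equally spaced endpoints, where `ρ(t, h) = K_{t,t}(h, h)`.

Both `∂_t` and `∂_E` are tangent to the diagonal, so they commute with the expansion: any product
`D` of them satisfies `D L (ε a) = -ε r (D ρ)(0, 0) + o(ε)`, with `∂_E` read as `∂_h` on the right.
The Wronskian at `ε a` is therefore `ε² r² (ρ_hhh ρ_thhh - ρ_thh ρ_hhhh) + o(ε²)`, derivatives of
`ρ` being taken at the origin.

An `h`-derivative of `ρ` produces a factor `V - U` that cancels `1 / (U - V)`, leaving moments `∫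
V^j U^k` that split into single integrals. Symmetry kills all the moments needed except `M = ∫ V U²
> 0`. This gives `ρ_hhh = 0`, `ρ_hhhh = -3M`, `ρ_thh = -M/2`, and the leading coefficient `-(3/2) r²
M²` is nonzero. The carrying lemmas are `hasDerivAt_dirDerivs_smul`, `fderiv_logExtension_diagonal`
and `contourMoment_one_two_pos`. -/

/-! ### Smoothness of exponential integrals with values in a Banach algebra -/

section ExponentialIntegral

set_option linter.unusedSectionVars false

theorem NormedSpace.norm_exp_le_exp_norm {𝔸 : Type*} [NormedCommRing 𝔸] [NormedAlgebra ℝ 𝔸]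
    [CompleteSpace 𝔸] [NormOneClass 𝔸] (a : 𝔸) : ‖NormedSpace.exp a‖ ≤ Real.exp ‖a‖ := by
  have h : HasSum (fun n : ℕ => ‖a‖ ^ n / (n.factorial : ℝ)) (Real.exp ‖a‖) := by
    rw [Real.exp_eq_exp_ℝ]
    exact NormedSpace.expSeries_div_hasSum_exp ‖a‖
  rw [congrFun (NormedSpace.exp_eq_tsum ℝ) a]
  refine tsum_of_norm_bounded h fun n => ?_
  rw [norm_smul, norm_inv, Real.norm_natCast, div_eq_inv_mul]
  gcongr
  exact norm_pow_le a n

variable {Ω E 𝔸 : Type*} [MeasurableSpace Ω] {μ : Measure Ω}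
  [NormedAddCommGroup E] [NormedSpace ℝ E]
  [NormedCommRing 𝔸] [NormedAlgebra ℝ 𝔸]

/-- `W` has exponential moments of all orders with respect to the gauge `g`. -/
structure ExpIntegrable (μ : Measure Ω) (g : Ω → ℝ) (W : Ω → 𝔸) : Prop where
  aestronglyMeasurable : AEStronglyMeasurable W μ
  integrable : ∀ R : ℝ, Integrable (fun ω => ‖W ω‖ * Real.exp (R * g ω)) μ

/-- A measurable family of linear maps dominated by a multiple of the gauge `g`. -/
structure GaugeBounded (μ : Measure Ω) (g : Ω → ℝ) (l : Ω → E →L[ℝ] 𝔸) : Prop where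
  aestronglyMeasurable : AEStronglyMeasurable l μ
  gauge : AEStronglyMeasurable g μ
  bound : ∃ c : ℝ, ∀ ω, ‖l ω‖ ≤ c * g ω

/-- The factor `l ω v` is at most `exp (c * g ω) * ‖v‖`, which is absorbed by replacing `R` with `R
+ c`. This closure property is why moments of every order `R` are required. -/
theorem ExpIntegrable.mul_apply {g : Ω → ℝ} {W : Ω → 𝔸} (hW : ExpIntegrable μ g W)
    {l : Ω → E →L[ℝ] 𝔸} (hl : GaugeBounded μ g l) (v : E) :
    ExpIntegrable μ g (fun ω => W ω * l ω v) := by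
  obtain ⟨c, hc⟩ := hl.bound
  have hm : AEStronglyMeasurable (fun ω => W ω * l ω v) μ :=
    hW.aestronglyMeasurable.mul (hl.aestronglyMeasurable.apply_continuousLinearMap v)
  refine ⟨hm, fun R => ?_⟩
  have hg : AEStronglyMeasurable (fun ω => Real.exp (R * g ω)) μ :=
    Real.continuous_exp.comp_aestronglyMeasurable (hl.gauge.const_mul R)
  refine ((hW.integrable (R + c)).const_mul ‖v‖).mono' (hm.norm.mul hg) ?_
  filter_upwards with ω
  have h1 : ‖l ω v‖ ≤ Real.exp (c * g ω) * ‖v‖ :=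
    ((l ω).le_of_opNorm_le (hc ω) v).trans
      (mul_le_mul_of_nonneg_right ((le_add_of_nonneg_right zero_le_one).trans
        (Real.add_one_le_exp _)) (norm_nonneg v))
  rw [Real.norm_of_nonneg (by positivity)]
  calc ‖W ω * l ω v‖ * Real.exp (R * g ω)
      ≤ (‖W ω‖ * (Real.exp (c * g ω) * ‖v‖)) * Real.exp (R * g ω) := by
        gcongr
        exact (norm_mul_le _ _).trans (by gcongr)
    _ = ‖v‖ * (‖W ω‖ * Real.exp ((R + c) * g ω)) := by
        rw [add_mul, Real.exp_add]; ring

/-- The function `z ↦ ∫ W(ω) exp(l_ω(z)) dμ(ω)`. -/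
noncomputable def expIntegral (μ : Measure Ω) (l : Ω → E →L[ℝ] 𝔸) (W : Ω → 𝔸) (z : E) : 𝔸 :=
  ∫ ω, W ω * NormedSpace.exp (l ω z) ∂μ

/-- The linear map `v ↦ b * l v`. -/
noncomputable def mulComp (b : 𝔸) (l : E →L[ℝ] 𝔸) : E →L[ℝ] 𝔸 :=
  (ContinuousLinearMap.mul ℝ 𝔸 b).comp l

theorem continuous_mulComp : Continuous fun p : 𝔸 × (E →L[ℝ] 𝔸) => mulComp p.1 p.2 := by
  unfold mulComp
  fun_prop

theorem norm_mulComp_le (b : 𝔸) (l : E →L[ℝ] 𝔸) : ‖mulComp b l‖ ≤ ‖b‖ * ‖l‖ :=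
  (ContinuousLinearMap.opNorm_comp_le _ _).trans
    (mul_le_mul_of_nonneg_right (ContinuousLinearMap.opNorm_mul_apply_le ℝ 𝔸 b) (norm_nonneg l))

variable [CompleteSpace 𝔸] [NormOneClass 𝔸]

theorem ExpIntegrable.norm_mul_exp_le {g : Ω → ℝ} (W : Ω → 𝔸)
    {l : Ω → E →L[ℝ] 𝔸} {c : ℝ} (hc : ∀ ω, ‖l ω‖ ≤ c * g ω) {z : E} {R : ℝ} (hz : ‖z‖ ≤ R)
    (ω : Ω) : ‖W ω * NormedSpace.exp (l ω z)‖ ≤ ‖W ω‖ * Real.exp (c * R * g ω) := by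
  refine (norm_mul_le _ _).trans ?_
  gcongr
  refine (NormedSpace.norm_exp_le_exp_norm _).trans (Real.exp_le_exp.2 ?_)
  refine ((l ω).le_of_opNorm_le (hc ω) z).trans ?_
  calc c * g ω * ‖z‖ ≤ c * g ω * R :=
        mul_le_mul_of_nonneg_left hz ((norm_nonneg _).trans (hc ω))
    _ = c * R * g ω := by ring

theorem ExpIntegrable.aestronglyMeasurable_mul_exp {g : Ω → ℝ} {W : Ω → 𝔸}
    (hW : ExpIntegrable μ g W) {l : Ω → E →L[ℝ] 𝔸} (hl : GaugeBounded μ g l) (z : E) :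
    AEStronglyMeasurable (fun ω => W ω * NormedSpace.exp (l ω z)) μ := by
  let _ : NormedAlgebra ℚ 𝔸 := NormedAlgebra.restrictScalars ℚ ℝ 𝔸
  exact hW.aestronglyMeasurable.mul (NormedSpace.exp_continuous.comp_aestronglyMeasurable
    (hl.aestronglyMeasurable.apply_continuousLinearMap z))

theorem ExpIntegrable.integrable_mul_exp {g : Ω → ℝ} {W : Ω → 𝔸}
    (hW : ExpIntegrable μ g W) {l : Ω → E →L[ℝ] 𝔸} (hl : GaugeBounded μ g l) (z : E) :
    Integrable (fun ω => W ω * NormedSpace.exp (l ω z)) μ := by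
  obtain ⟨c, hc⟩ := hl.bound
  exact (hW.integrable (c * ‖z‖)).mono' (hW.aestronglyMeasurable_mul_exp hl z)
    (Filter.Eventually.of_forall (ExpIntegrable.norm_mul_exp_le W hc le_rfl))

theorem ExpIntegrable.integrable_mulComp {g : Ω → ℝ} {W : Ω → 𝔸}
    (hW : ExpIntegrable μ g W) {l : Ω → E →L[ℝ] 𝔸} (hl : GaugeBounded μ g l) (z : E) :
    Integrable (fun ω => mulComp (W ω * NormedSpace.exp (l ω z)) (l ω)) μ := by
  obtain ⟨c, hc⟩ := hl.bound
  refine (hW.integrable (c * ‖z‖ + c)).mono' (continuous_mulComp.comp_aestronglyMeasurable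
    ((hW.aestronglyMeasurable_mul_exp hl z).prodMk hl.aestronglyMeasurable)) ?_
  filter_upwards with ω
  rw [add_mul, Real.exp_add, ← mul_assoc]
  refine (norm_mulComp_le _ _).trans ?_
  gcongr
  · exact ExpIntegrable.norm_mul_exp_le W hc le_rfl ω
  · exact (hc ω).trans ((le_add_of_nonneg_right zero_le_one).trans (Real.add_one_le_exp _))

theorem ExpIntegrable.hasFDerivAt {g : Ω → ℝ} {W : Ω → 𝔸}
    (hW : ExpIntegrable μ g W) {l : Ω → E →L[ℝ] 𝔸} (hl : GaugeBounded μ g l) (z : E) :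
    HasFDerivAt (expIntegral μ l W)
      (∫ ω, mulComp (W ω * NormedSpace.exp (l ω z)) (l ω) ∂μ) z := by
  obtain ⟨c, hc⟩ := hl.bound
  refine hasFDerivAt_integral_of_dominated_of_fderiv_le
    (s := Metric.ball z 1) (F' := fun z ω => mulComp (W ω * NormedSpace.exp (l ω z)) (l ω))
    (bound := fun ω => ‖W ω‖ * Real.exp ((c * (‖z‖ + 1) + c) * g ω))
    (Metric.ball_mem_nhds z one_pos)
    (Filter.Eventually.of_forall (hW.aestronglyMeasurable_mul_exp hl))
    (hW.integrable_mul_exp hl z)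
    (hW.integrable_mulComp hl z).aestronglyMeasurable ?_
    (hW.integrable _) ?_
  · filter_upwards with ω x hx
    have hx' : ‖x‖ ≤ ‖z‖ + 1 := by
      have := norm_sub_norm_le x z
      rw [mem_ball_iff_norm] at hx
      linarith
    rw [add_mul, Real.exp_add, ← mul_assoc]
    refine (norm_mulComp_le _ _).trans ?_
    gcongr
    · exact ExpIntegrable.norm_mul_exp_le W hc hx' ω
    · exact (hc ω).trans ((le_add_of_nonneg_right zero_le_one).trans (Real.add_one_le_exp _))
  · filter_upwards with ω x hx
    have h := ((hasFDerivAt_exp (𝕂 := ℝ) (x := l ω x)).comp x (l ω).hasFDerivAt).const_mul (W ω)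
    refine h.congr_fderiv ?_
    ext v
    simp [mulComp, mul_assoc]

theorem ExpIntegrable.fderiv_apply {g : Ω → ℝ} {W : Ω → 𝔸}
    (hW : ExpIntegrable μ g W) {l : Ω → E →L[ℝ] 𝔸} (hl : GaugeBounded μ g l) (z v : E) :
    fderiv ℝ (expIntegral μ l W) z v = expIntegral μ l (fun ω => W ω * l ω v) z := by
  rw [(hW.hasFDerivAt hl z).fderiv,
    ContinuousLinearMap.integral_apply (hW.integrable_mulComp hl z), expIntegral]
  refine integral_congr_ae (Filter.Eventually.of_forall fun ω => ?_)
  simp only [mulComp, ContinuousLinearMap.comp_apply, ContinuousLinearMap.mul_apply']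
  ring

/-- Differentiating along `v` only replaces `W` by `W * l v`, a weight of the same class, so
induction on the order applies with `W` general. -/
theorem ExpIntegrable.contDiff [FiniteDimensional ℝ E] {g : Ω → ℝ} {W : Ω → 𝔸}
    (hW : ExpIntegrable μ g W) {l : Ω → E →L[ℝ] 𝔸} (hl : GaugeBounded μ g l) :
    ContDiff ℝ (⊤ : ℕ∞) (expIntegral μ l W) := by
  refine contDiff_infty.2 fun n => ?_
  induction n generalizing W with
  | zero =>
    exact contDiff_zero.2 (continuous_iff_continuousAt.2 fun z =>
      (hW.hasFDerivAt hl z).continuousAt)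
  | succ n ih =>
    push_cast
    rw [contDiff_succ_iff_fderiv_apply]
    refine ⟨fun z => (hW.hasFDerivAt hl z).differentiableAt, by simp, fun v => ?_⟩
    simp_rw [hW.fderiv_apply hl]
    exact ih (hW.mul_apply hl v)

end ExponentialIntegral

/-! ### The Fredholm determinant as an analytic function of a continuous kernel -/

section FredholmFunctional

variable {X : Type*} [TopologicalSpace X] [CompactSpace X] [SecondCountableTopology X]
  [MeasurableSpace X] [BorelSpace X]

theorem ContinuousMap.integrable_of_compactSpace {Y : Type*} [TopologicalSpace Y] [CompactSpace Y]
    [MeasurableSpace Y] [OpensMeasurableSpace Y] (ν : Measure Y) [IsFiniteMeasure ν]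
    (f : C(Y, ℝ)) : Integrable f ν :=
  f.continuous.integrable_of_hasCompactSupport (HasCompactSupport.of_compactSpace f)

/-- Integration of continuous functions on a compact space, as a linear form. -/
noncomputable def integralLinear {Y : Type*} [TopologicalSpace Y] [CompactSpace Y]
    [MeasurableSpace Y] [OpensMeasurableSpace Y] (ν : Measure Y) [IsFiniteMeasure ν] :
    C(Y, ℝ) →ₗ[ℝ] ℝ where
  toFun f := ∫ y, f y ∂ν
  map_add' f g := integral_add (f.integrable_of_compactSpace ν) (g.integrable_of_compactSpace ν)
  map_smul' c f := integral_const_mul c f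

/-- The map `x ↦ (x_{σ i}, x_i)`. -/
def permPair {n : ℕ} (σ : Equiv.Perm (Fin n)) (i : Fin n) : C(Fin n → X, X × X) where
  toFun x := (x (σ i), x i)

/-- The polarization of `k ↦ ∫ det (k (x i) (x j))`. -/
noncomputable def detIntegralMultilinear (μ : Measure X) [IsFiniteMeasure μ] (n : ℕ) :
    MultilinearMap ℝ (fun _ : Fin n => C(X × X, ℝ)) ℝ :=
  ∑ σ : Equiv.Perm (Fin n), ((Equiv.Perm.sign σ : ℤ) : ℝ) •
    (integralLinear (Measure.pi fun _ : Fin n => μ)).compMultilinearMap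
      ((MultilinearMap.mkPiAlgebra ℝ (Fin n) C(Fin n → X, ℝ)).compLinearMap
        fun i => (ContinuousMap.compRightAlgHom ℝ ℝ (permPair σ i)).toLinearMap)

theorem detIntegralMultilinear_apply (μ : Measure X) [IsFiniteMeasure μ] (n : ℕ)
    (k : Fin n → C(X × X, ℝ)) :
    detIntegralMultilinear μ n k = ∑ σ : Equiv.Perm (Fin n), ((Equiv.Perm.sign σ : ℤ) : ℝ) *
      ∫ x, ∏ i, k i (x (σ i), x i) ∂(Measure.pi fun _ : Fin n => μ) := by
  simp [detIntegralMultilinear, integralLinear, permPair]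

/-- Counting permutations is enough, without Hadamard's inequality: the factor `n!` cancels against
Fredholm's `1 / n!`, leaving a geometric bound and hence a positive radius. Only kernels near `0`
matter later. -/
theorem norm_detIntegralMultilinear_le (μ : Measure X) [IsFiniteMeasure μ] (n : ℕ)
    (k : Fin n → C(X × X, ℝ)) :
    ‖detIntegralMultilinear μ n k‖ ≤ (n.factorial * μ.real Set.univ ^ n) * ∏ i, ‖k i‖ := by
  rw [detIntegralMultilinear_apply]
  refine (norm_sum_le _ _).trans ?_
  have h : ∀ σ ∈ (Finset.univ : Finset (Equiv.Perm (Fin n))),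
      ‖((Equiv.Perm.sign σ : ℤ) : ℝ) *
        ∫ x, ∏ i, k i (x (σ i), x i) ∂(Measure.pi fun _ : Fin n => μ)‖ ≤
      μ.real Set.univ ^ n * ∏ i, ‖k i‖ := by
    intro σ _
    rw [norm_mul]
    have h1 : ‖((Equiv.Perm.sign σ : ℤ) : ℝ)‖ = 1 := by
      rcases Int.units_eq_one_or (Equiv.Perm.sign σ) with h | h <;> simp [h]
    rw [h1, one_mul]
    refine (norm_integral_le_of_norm_le_const (C := ∏ i, ‖k i‖)
      (Filter.Eventually.of_forall fun x => ?_)).trans ?_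
    · rw [norm_prod]
      exact Finset.prod_le_prod (fun _ _ => norm_nonneg _) fun i _ => (k i).norm_coe_le_norm _
    · rw [mul_comm]
      gcongr
      simp [Measure.real, Measure.pi_univ]
  refine (Finset.sum_le_sum h).trans (le_of_eq ?_)
  rw [Finset.sum_const, Finset.card_univ, Fintype.card_perm, Fintype.card_fin, nsmul_eq_mul]
  ring

/-- The power series of `k ↦ det (1 - k)` on the space of continuous kernels. -/
noncomputable def fredholmSeries (μ : Measure X) [IsFiniteMeasure μ] :
    FormalMultilinearSeries ℝ C(X × X, ℝ) ℝ := fun n =>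
  ((-1 : ℝ) ^ n / (n.factorial : ℝ)) •
    (detIntegralMultilinear μ n).mkContinuous _ (norm_detIntegralMultilinear_le μ n)

theorem fredholmSeries_apply (μ : Measure X) [IsFiniteMeasure μ] (n : ℕ) (k : C(X × X, ℝ)) :
    fredholmSeries μ n (fun _ => k) = (-1 : ℝ) ^ n / (n.factorial : ℝ) *
      ∫ x, (Matrix.of fun i j => k (x i, x j)).det ∂(Measure.pi fun _ : Fin n => μ) := by
  simp only [fredholmSeries, smul_apply, MultilinearMap.coe_mkContinuous,
    detIntegralMultilinear_apply, smul_eq_mul, Matrix.det_apply', Matrix.of_apply]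
  rw [integral_finsetSum]
  · simp_rw [integral_const_mul]
  · intro σ _
    refine Integrable.const_mul ?_ _
    exact (Continuous.integrable_of_hasCompactSupport (by fun_prop)
      (HasCompactSupport.of_compactSpace _))

theorem norm_fredholmSeries_le (μ : Measure X) [IsFiniteMeasure μ] (n : ℕ) :
    ‖fredholmSeries μ n‖ ≤ μ.real Set.univ ^ n := by
  refine ContinuousMultilinearMap.opNorm_le_bound (by positivity) fun k => ?_
  have h : fredholmSeries μ n k =
      (-1 : ℝ) ^ n / (n.factorial : ℝ) * detIntegralMultilinear μ n k := rfl
  rw [h, norm_mul, norm_div, norm_pow, norm_neg, norm_one, one_pow, Real.norm_natCast]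
  calc _ ≤ 1 / (n.factorial : ℝ) * ((n.factorial * μ.real Set.univ ^ n) * ∏ i, ‖k i‖) := by
        gcongr
        exact norm_detIntegralMultilinear_le μ n k
    _ = _ := by field_simp

theorem fredholmSeries_radius_pos (μ : Measure X) [IsFiniteMeasure μ] :
    0 < (fredholmSeries μ).radius := by
  set m : ℝ := μ.real Set.univ with hm
  have hm0 : 0 ≤ m := measureReal_nonneg
  let r : NNReal := ⟨(m + 1)⁻¹, by positivity⟩
  have hr : (r : ENNReal) ≤ (fredholmSeries μ).radius := by
    refine (fredholmSeries μ).le_radius_of_bound 1 fun n => ?_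
    calc ‖fredholmSeries μ n‖ * (r : ℝ) ^ n ≤ m ^ n * (m + 1)⁻¹ ^ n := by
          gcongr
          · exact norm_fredholmSeries_le μ n
          · exact le_rfl
      _ = (m * (m + 1)⁻¹) ^ n := (mul_pow _ _ _).symm
      _ ≤ 1 := pow_le_one₀ (by positivity) (by
          rw [mul_inv_le_iff₀ (by positivity)]; linarith)
  refine lt_of_lt_of_le ?_ hr
  rw [ENNReal.coe_pos, ← NNReal.coe_pos]
  exact inv_pos.2 (by linarith)

/-- The Fredholm determinant `det (1 - k)` as a function of the continuous kernel `k`. -/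
noncomputable def fredholmFunctional (μ : Measure X) [IsFiniteMeasure μ] (k : C(X × X, ℝ)) : ℝ :=
  ∑' n : ℕ, (-1 : ℝ) ^ n / (n.factorial : ℝ) *
    ∫ x, (Matrix.of fun i j => k (x i, x j)).det ∂(Measure.pi fun _ : Fin n => μ)

theorem hasFPowerSeriesOnBall_fredholmFunctional (μ : Measure X) [IsFiniteMeasure μ] :
    HasFPowerSeriesOnBall (fredholmFunctional μ) (fredholmSeries μ) 0
      (fredholmSeries μ).radius := by
  have h : fredholmFunctional μ = (fredholmSeries μ).sum := by
    funext k
    simp only [fredholmFunctional, FormalMultilinearSeries.sum, fredholmSeries_apply]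
  rw [h]
  exact (fredholmSeries μ).hasFPowerSeriesOnBall (fredholmSeries_radius_pos μ)

theorem contDiffAt_fredholmFunctional (μ : Measure X) [IsFiniteMeasure μ] :
    ∀ᶠ k in nhds (0 : C(X × X, ℝ)), ContDiffAt ℝ (⊤ : ℕ∞) (fredholmFunctional μ) k := by
  filter_upwards [(hasFPowerSeriesOnBall_fredholmFunctional μ).analyticAt.eventually_analyticAt]
    with k hk
  exact hk.contDiffAt

theorem fredholmFunctional_zero (μ : Measure X) [IsFiniteMeasure μ] :
    fredholmFunctional μ 0 = 1 := by
  rw [← (hasFPowerSeriesOnBall_fredholmFunctional μ).coeff_zero (fun _ => 0), fredholmSeries_apply]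
  simp [Measure.real]

/-- The term `n = 1` of Fredholm's series is minus the trace. -/
theorem fderiv_fredholmFunctional_zero (μ : Measure X) [IsFiniteMeasure μ] (k : C(X × X, ℝ)) :
    fderiv ℝ (fredholmFunctional μ) 0 k = -∫ x, k (x, x) ∂μ := by
  rw [(hasFPowerSeriesOnBall_fredholmFunctional μ).hasFPowerSeriesAt.hasFDerivAt.fderiv,
    continuousMultilinearCurryFin1_apply]
  have : (Fin.snoc 0 k : Fin 1 → C(X × X, ℝ)) = fun _ => k := by
    funext i
    fin_cases i
    simp [Fin.snoc]
  rw [this, fredholmSeries_apply]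
  have h := (measurePreserving_funUnique μ (Fin 1)).integral_comp
    (MeasurableEquiv.measurableEmbedding _) (fun x => k (x, x))
  simp only [Nat.factorial, pow_one, Matrix.det_unique, Matrix.of_apply]
  rw [← h]
  simp [MeasurableEquiv.funUnique]
  rfl

end FredholmFunctional

/-! ### The double contour as a measure space, and integrability of the weight -/

section KernelIntegral

theorem pearceyOmega_sq : pearceyOmega ^ 2 = Complex.I := by
  rw [pearceyOmega, ← Complex.exp_nat_mul]
  refine Eq.trans ?_ Complex.exp_pi_div_two_mul_I
  congr 1
  push_cast
  ring

theorem conj_pearceyOmega_sq : (starRingEnd ℂ) pearceyOmega ^ 2 = -Complex.I := by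
  rw [← map_pow, pearceyOmega_sq, Complex.conj_I]

/-- The directions of the four rays of the contour `X`. -/
noncomputable def rayDir : Fin 4 → ℂ :=
  ![pearceyOmega, -pearceyOmega, (starRingEnd ℂ) pearceyOmega, -(starRingEnd ℂ) pearceyOmega]

/-- The orientations of the four rays of the contour `X`. -/
noncomputable def raySign : Fin 4 → ℂ := ![-1, -1, 1, 1]

theorem rayDir_pow_four (i : Fin 4) : rayDir i ^ 4 = -1 := by
  have h : ∀ z : ℂ, z ^ 2 = Complex.I ∨ z ^ 2 = -Complex.I → z ^ 4 = -1 := by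
    intro z hz
    have : z ^ 4 = (z ^ 2) ^ 2 := by ring
    rcases hz with hz | hz <;> rw [this, hz] <;> simp
  apply h
  fin_cases i <;> simp [rayDir, pearceyOmega_sq, conj_pearceyOmega_sq]

theorem norm_rayDir (i : Fin 4) : ‖rayDir i‖ = 1 := by
  have h : ‖rayDir i‖ ^ 4 = 1 := by rw [← norm_pow, rayDir_pow_four]; simp
  exact (pow_eq_one_iff_of_nonneg (norm_nonneg _) (by norm_num)).1 h

theorem pearceyOmega_re : pearceyOmega.re = Real.sqrt 2 / 2 := by
  rw [pearceyOmega, Complex.exp_ofReal_mul_I_re, Real.cos_pi_div_four]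

theorem pearceyOmega_im : pearceyOmega.im = Real.sqrt 2 / 2 := by
  rw [pearceyOmega, Complex.exp_ofReal_mul_I_im, Real.sin_pi_div_four]

theorem rayDir_re_sq (i : Fin 4) : (rayDir i).re ^ 2 = 1 / 2 := by
  have h : (Real.sqrt 2 / 2) ^ 2 = 1 / 2 := by rw [div_pow, Real.sq_sqrt (by norm_num)]; norm_num
  fin_cases i <;> simp [rayDir, pearceyOmega_re] <;> simpa using h

theorem rayDir_im_sq (i : Fin 4) : (rayDir i).im ^ 2 = 1 / 2 := by
  have h : (Real.sqrt 2 / 2) ^ 2 = 1 / 2 := by rw [div_pow, Real.sq_sqrt (by norm_num)]; norm_num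
  fin_cases i <;> simp [rayDir, pearceyOmega_im] <;> simpa using h

theorem norm_raySign (i : Fin 4) : ‖raySign i‖ = 1 := by
  fin_cases i <;> simp [raySign]

/-- The measure on the parameter space of the double contour. -/
noncomputable def contourMeasure : Measure (Fin 4 × ℝ × ℝ) :=
  Measure.count.prod ((volume.restrict (Set.Ioi 0)).prod volume)

/-- The point `V` of the contour `X`. -/
noncomputable def pointV (p : Fin 4 × ℝ × ℝ) : ℂ := p.2.1 * rayDir p.1

/-- The point `U` of the imaginary axis. -/
noncomputable def pointU (p : Fin 4 × ℝ × ℝ) : ℂ := p.2.2 * Complex.I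

/-- The weight of the double contour integral at `s = t = x = y = 0`, without `1 / (U - V)`. -/
noncomputable def baseWeight (p : Fin 4 × ℝ × ℝ) : ℂ :=
  -(1 / (4 * (Real.pi : ℂ) ^ 2)) * raySign p.1 * rayDir p.1 * Complex.I *
    Complex.exp (-(pointU p ^ 4 / 4)) * Complex.exp (pointV p ^ 4 / 4)

/-- The weight of the double contour integral at `s = t = x = y = 0`. -/
noncomputable def contourWeight (p : Fin 4 × ℝ × ℝ) : ℂ :=
  baseWeight p * (1 / (pointU p - pointV p))

/-- The gauge dominating all exponents. -/
noncomputable def contourGauge (p : Fin 4 × ℝ × ℝ) : ℝ := 1 + p.2.1 ^ 2 + p.2.2 ^ 2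

theorem pointU_pow_four (p : Fin 4 × ℝ × ℝ) : pointU p ^ 4 = ((p.2.2 ^ 4 : ℝ) : ℂ) := by
  rw [pointU, mul_pow, Complex.I_pow_four]; simp

theorem pointV_pow_four (p : Fin 4 × ℝ × ℝ) : pointV p ^ 4 = -((p.2.1 ^ 4 : ℝ) : ℂ) := by
  rw [pointV, mul_pow, rayDir_pow_four]; simp

theorem norm_baseWeight (p : Fin 4 × ℝ × ℝ) : ‖baseWeight p‖ =
    1 / (4 * Real.pi ^ 2) * (Real.exp (-(p.2.1 ^ 4 / 4)) * Real.exp (-(p.2.2 ^ 4 / 4))) := by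
  simp only [baseWeight, norm_mul, norm_raySign, norm_rayDir, Complex.norm_exp, pointU_pow_four,
    pointV_pow_four]
  have h1 : ((-(((p.2.2 ^ 4 : ℝ) : ℂ) / 4) : ℂ)).re = -(p.2.2 ^ 4 / 4) := by
    rw [show (-(((p.2.2 ^ 4 : ℝ) : ℂ) / 4) : ℂ) = ((-(p.2.2 ^ 4 / 4) : ℝ) : ℂ) by push_cast; ring]
    exact Complex.ofReal_re _
  have h2 : ((-((p.2.1 ^ 4 : ℝ) : ℂ) / 4 : ℂ)).re = -(p.2.1 ^ 4 / 4) := by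
    rw [show (-((p.2.1 ^ 4 : ℝ) : ℂ) / 4 : ℂ) = ((-(p.2.1 ^ 4 / 4) : ℝ) : ℂ) by push_cast; ring]
    exact Complex.ofReal_re _
  rw [h1, h2]
  simp [abs_of_pos Real.pi_pos]
  ring

/-- The rays make an angle `π/4` with the imaginary axis. A lower bound by a product controls `1 /
|U - V|` by `ρ^(-1/2) |u|^(-1/2)`, which is locally integrable and separates the variables. -/
theorem half_mul_le_norm_sub_sq (p : Fin 4 × ℝ × ℝ) :
    p.2.1 * |p.2.2| / 2 ≤ ‖pointU p - pointV p‖ ^ 2 := by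
  obtain ⟨i, ρ, u⟩ := p
  have h1 := rayDir_re_sq i
  have h2 := rayDir_im_sq i
  rw [← Complex.normSq_eq_norm_sq, Complex.normSq_apply]
  simp only [pointU, pointV, Complex.sub_re, Complex.sub_im, Complex.mul_re, Complex.mul_im,
    Complex.ofReal_re, Complex.ofReal_im, Complex.I_re, Complex.I_im]
  set a := (rayDir i).re
  set b := (rayDir i).im
  have h3 : ρ * |u| ≤ (ρ ^ 2 + u ^ 2) / 2 := by
    nlinarith [sq_nonneg (ρ - |u|), sq_abs u]
  -- With `b² = 1/2` the first square gives `2bρu ≤ 2u²/3 + 3ρ²/4`, hence `|U - V|² ≥ (ρ² + u²) /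
  -- 4`.
  nlinarith [sq_nonneg (4 * b * u - 3 * ρ), sq_nonneg ρ, sq_nonneg u]

theorem rayDir_re_ne_zero (i : Fin 4) : (rayDir i).re ≠ 0 := by
  intro h
  have := rayDir_re_sq i
  rw [h] at this
  norm_num at this

theorem pointU_ne_pointV {p : Fin 4 × ℝ × ℝ} (hp : 0 < p.2.1) : pointU p ≠ pointV p := by
  intro h
  have := congrArg Complex.re h
  simp [pointU, pointV] at this
  exact this.elim hp.ne' (rayDir_re_ne_zero _)

theorem ae_contourMeasure : ∀ᵐ p ∂contourMeasure, 0 < p.2.1 ∧ p.2.2 ≠ 0 := by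
  have h : ∀ᵐ q ∂((volume.restrict (Set.Ioi (0 : ℝ))).prod (volume : Measure ℝ)),
      0 < q.1 ∧ q.2 ≠ 0 := by
    refine (Measure.quasiMeasurePreserving_fst.ae (ae_restrict_mem measurableSet_Ioi)).and
      (Measure.quasiMeasurePreserving_snd.ae (p := fun u : ℝ => u ≠ 0) ?_)
    exact Measure.ae_ne volume 0
  exact Measure.quasiMeasurePreserving_snd.ae h

theorem measurable_rayDir : Measurable fun p : Fin 4 × ℝ × ℝ => rayDir p.1 :=
  (measurable_of_finite rayDir).comp measurable_fst

@[fun_prop]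
theorem measurable_pointV : Measurable pointV := by
  unfold pointV
  have := measurable_rayDir
  fun_prop

@[fun_prop]
theorem measurable_pointU : Measurable pointU := by
  unfold pointU
  fun_prop

@[fun_prop]
theorem measurable_baseWeight : Measurable baseWeight := by
  unfold baseWeight
  have := measurable_rayDir
  have h : Measurable fun p : Fin 4 × ℝ × ℝ => raySign p.1 :=
    (measurable_of_finite raySign).comp measurable_fst
  fun_prop

@[fun_prop]
theorem measurable_contourWeight : Measurable contourWeight := by
  unfold contourWeight
  fun_prop

@[fun_prop]
theorem measurable_contourGauge : Measurable contourGauge := by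
  unfold contourGauge
  fun_prop

theorem integrableOn_rpow_mul_exp_quartic (R : ℝ) :
    IntegrableOn (fun x : ℝ => x ^ (-(1 / 2) : ℝ) * Real.exp (-(x ^ 4 / 4) + R * x ^ 2))
      (Set.Ioi 0) := by
  -- The comparison is with `x^(-1/2) e^(-x)`. Completing the square in `x²` gives `-x⁴/4 + R x² ≤
  -- (R + 1/2)² - x²/2`, and `-x²/2 ≤ 1/2 - x`.
  have h := (Real.GammaIntegral_convergent (s := 1 / 2) (by norm_num)).const_mul
    (Real.exp ((R + 1 / 2) ^ 2 + 1 / 2))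
  refine h.mono' (by fun_prop) ?_
  filter_upwards [ae_restrict_mem measurableSet_Ioi] with x hx
  have hx : 0 < x := hx
  rw [Real.norm_of_nonneg (by positivity), show (1 / 2 - 1 : ℝ) = -(1 / 2) by norm_num, ← mul_assoc,
    ← Real.exp_add, mul_comm]
  refine mul_le_mul_of_nonneg_right (Real.exp_le_exp.2 ?_) (by positivity)
  nlinarith [sq_nonneg (x ^ 2 / 2 - (R + 1 / 2)), sq_nonneg (x - 1)]

theorem integrable_comp_abs_of_integrableOn {f : ℝ → ℝ} (hf : IntegrableOn f (Set.Ioi 0)) :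
    Integrable fun x => f |x| := by
  have h1 : IntegrableOn (fun x => f |x|) (Set.Ioi 0) :=
    hf.congr_fun (fun x hx => by rw [abs_of_pos hx]) measurableSet_Ioi
  have h2 : IntegrableOn (fun x => f |x|) (Set.Iic 0) := by
    rw [← Measure.map_neg_eq_self (volume : Measure ℝ)]
    let m : MeasurableEmbedding fun x : ℝ => -x := (Homeomorph.neg ℝ).measurableEmbedding
    rw [m.integrableOn_map_iff]
    simp_rw [Function.comp_def, abs_neg, Set.neg_preimage, Set.neg_Iic, neg_zero]
    exact Iff.mpr integrableOn_Ici_iff_integrableOn_Ioi h1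
  rw [← integrableOn_univ, ← Set.Iic_union_Ioi (a := (0 : ℝ))]
  exact h2.union h1

theorem expIntegrable_contourWeight :
    ExpIntegrable contourMeasure contourGauge contourWeight := by
  refine ⟨measurable_contourWeight.aestronglyMeasurable, fun R => ?_⟩
  have h1 := integrableOn_rpow_mul_exp_quartic R
  have h2 := integrable_comp_abs_of_integrableOn h1
  have h3 : Integrable (fun p : Fin 4 × ℝ × ℝ => Real.exp R *
      ((p.2.1 ^ (-(1 / 2) : ℝ) * Real.exp (-(p.2.1 ^ 4 / 4) + R * p.2.1 ^ 2)) *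
        (|p.2.2| ^ (-(1 / 2) : ℝ) * Real.exp (-(|p.2.2| ^ 4 / 4) + R * |p.2.2| ^ 2))))
      contourMeasure :=
    (integrable_const (Real.exp R)).mul_prod (h1.mul_prod h2)
  refine h3.mono' (by fun_prop) ?_
  filter_upwards [ae_contourMeasure] with p ⟨hρ, hu⟩
  rw [Real.norm_of_nonneg (by positivity), contourWeight, norm_mul, norm_baseWeight, norm_div,
    norm_one]
  have h4 := half_mul_le_norm_sub_sq p
  have hu' : 0 < |p.2.2| := abs_pos.2 hu
  have h5 : 1 / ‖pointU p - pointV p‖ ≤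
      2 * (p.2.1 ^ (-(1 / 2) : ℝ) * |p.2.2| ^ (-(1 / 2) : ℝ)) := by
    rw [← Real.mul_rpow hρ.le hu'.le, Real.rpow_neg (by positivity), ← Real.sqrt_eq_rpow]
    have hs : 0 < Real.sqrt (p.2.1 * |p.2.2|) := Real.sqrt_pos.2 (by positivity)
    have hs2 : Real.sqrt (p.2.1 * |p.2.2|) ^ 2 = p.2.1 * |p.2.2| := Real.sq_sqrt (by positivity)
    have h6 : Real.sqrt (p.2.1 * |p.2.2|) / 2 ≤ ‖pointU p - pointV p‖ :=
      abs_le_of_sq_le_sq' (by nlinarith) (norm_nonneg _) |>.2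
    calc 1 / ‖pointU p - pointV p‖ ≤ 1 / (Real.sqrt (p.2.1 * |p.2.2|) / 2) := by gcongr
      _ = _ := by field_simp
  have h7 : 1 / (4 * Real.pi ^ 2) ≤ 1 / 2 := by
    gcongr
    nlinarith [Real.pi_gt_three]
  have h8 : contourGauge p = 1 + p.2.1 ^ 2 + |p.2.2| ^ 2 := by rw [contourGauge, sq_abs]
  have h9 : |p.2.2| ^ 4 = p.2.2 ^ 4 := by rw [pow_abs, abs_of_nonneg (by positivity)]
  calc _ ≤ 1 / 2 * (Real.exp (-(p.2.1 ^ 4 / 4)) * Real.exp (-(p.2.2 ^ 4 / 4))) *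
        (2 * (p.2.1 ^ (-(1 / 2) : ℝ) * |p.2.2| ^ (-(1 / 2) : ℝ))) *
        Real.exp (R * contourGauge p) := by gcongr
    _ = _ := by
      rw [h8, h9, mul_add, mul_add, mul_one, Real.exp_add, Real.exp_add, Real.exp_add, Real.exp_add]
      ring

end KernelIntegral

/-! ### The Pearcey kernel as an exponential integral -/

section KernelFormula

set_option linter.unusedSectionVars false

/-- The coefficient of `t` in the exponent of the Pearcey kernel `K_{t,t}`. -/
noncomputable def exponentT (p : Fin 4 × ℝ × ℝ) : ℂ := (pointU p ^ 2 - pointV p ^ 2) / 2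

@[fun_prop]
theorem measurable_exponentT : Measurable exponentT := by
  unfold exponentT
  fun_prop

theorem norm_pointV_sq (p : Fin 4 × ℝ × ℝ) : ‖pointV p‖ ^ 2 = p.2.1 ^ 2 := by
  simp [pointV, norm_rayDir]

theorem norm_pointU_sq (p : Fin 4 × ℝ × ℝ) : ‖pointU p‖ ^ 2 = p.2.2 ^ 2 := by
  simp [pointU]

theorem norm_pointV_le (p : Fin 4 × ℝ × ℝ) : ‖pointV p‖ ≤ contourGauge p := by
  have := norm_pointV_sq p
  rw [contourGauge]
  nlinarith [sq_nonneg (‖pointV p‖ - 1), sq_nonneg p.2.2, sq_nonneg p.2.1]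

theorem norm_pointU_le (p : Fin 4 × ℝ × ℝ) : ‖pointU p‖ ≤ contourGauge p := by
  have := norm_pointU_sq p
  rw [contourGauge]
  nlinarith [sq_nonneg (‖pointU p‖ - 1), sq_nonneg p.2.2, sq_nonneg p.2.1]

theorem norm_exponentT_le (p : Fin 4 × ℝ × ℝ) : ‖exponentT p‖ ≤ contourGauge p := by
  have h := norm_sub_le (pointU p ^ 2) (pointV p ^ 2)
  rw [norm_pow, norm_pow, norm_pointU_sq, norm_pointV_sq] at h
  rw [exponentT, norm_div, contourGauge]
  simp only [Complex.norm_ofNat]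
  linarith [sq_nonneg p.2.2, sq_nonneg p.2.1]

variable {E 𝔸 : Type*} [NormedAddCommGroup E] [NormedSpace ℝ E]
  [NormedCommRing 𝔸] [NormedAlgebra ℝ 𝔸] {φ : ℂ →+* 𝔸}

/-- The exponent of the Pearcey kernel `K_{t,t}(x,y)`, with `t`, `x` and `y` linear functions with
values in an algebra. -/
noncomputable def contourExponent (φ : ℂ →+* 𝔸) (T₁ T₂ T₃ : E →L[ℝ] 𝔸) (p : Fin 4 × ℝ × ℝ) :
    E →L[ℝ] 𝔸 :=
  mulComp (φ (exponentT p)) T₁ + mulComp (φ (pointV p)) T₂ - mulComp (φ (pointU p)) T₃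

theorem contourExponent_apply (T₁ T₂ T₃ : E →L[ℝ] 𝔸) (p : Fin 4 × ℝ × ℝ) (z : E) :
    contourExponent φ T₁ T₂ T₃ p z =
      φ (exponentT p) * T₁ z + φ (pointV p) * T₂ z - φ (pointU p) * T₃ z := rfl

/-- Stated for a general algebra because it serves twice: with values in `ℂ` for the kernel at a
point, and in `C(Y, ℂ)` for the kernel as an element of a function space. -/
theorem gaugeBounded_contourExponent (hφ : ∀ z, ‖φ z‖ = ‖z‖) (T₁ T₂ T₃ : E →L[ℝ] 𝔸) :
    GaugeBounded contourMeasure contourGauge (contourExponent φ T₁ T₂ T₃) := by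
  have hc : Continuous φ := (AddMonoidHomClass.isometry_of_norm φ hφ).continuous
  have hm : ∀ (f : Fin 4 × ℝ × ℝ → ℂ), Measurable f → ∀ T : E →L[ℝ] 𝔸,
      AEStronglyMeasurable (fun p => mulComp (φ (f p)) T) contourMeasure := fun f hf T =>
    (continuous_mulComp.comp (hc.prodMk continuous_const)).comp_aestronglyMeasurable
      hf.aestronglyMeasurable
  refine ⟨?_, measurable_contourGauge.aestronglyMeasurable, ‖T₁‖ + ‖T₂‖ + ‖T₃‖, fun p => ?_⟩
  · exact ((hm _ measurable_exponentT T₁).add (hm _ measurable_pointV T₂)).sub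
      (hm _ measurable_pointU T₃)
  · have hb : ∀ (z : ℂ), ‖z‖ ≤ contourGauge p → ∀ T : E →L[ℝ] 𝔸,
        ‖mulComp (φ z) T‖ ≤ contourGauge p * ‖T‖ := fun z hz T => by
      refine (norm_mulComp_le _ _).trans ?_
      rw [hφ]
      gcongr
    have h1 := hb _ (norm_exponentT_le p) T₁
    have h2 := hb _ (norm_pointV_le p) T₂
    have h3 := hb _ (norm_pointU_le p) T₃
    have h4 := norm_sub_le (mulComp (φ (exponentT p)) T₁ + mulComp (φ (pointV p)) T₂)
      (mulComp (φ (pointU p)) T₃)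
    have h5 := norm_add_le (mulComp (φ (exponentT p)) T₁) (mulComp (φ (pointV p)) T₂)
    rw [contourExponent]
    linarith

theorem expIntegrable_map_contourWeight (hφ : ∀ z, ‖φ z‖ = ‖z‖) :
    ExpIntegrable contourMeasure contourGauge (fun p => φ (contourWeight p)) := by
  refine ⟨(AddMonoidHomClass.isometry_of_norm φ hφ).continuous.comp_aestronglyMeasurable
    measurable_contourWeight.aestronglyMeasurable, fun R => ?_⟩
  simpa only [hφ] using expIntegrable_contourWeight.integrable R

/-- The exponent of the Pearcey kernel as a function of `(t, x, y)`. -/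
noncomputable def scalarExponent : Fin 4 × ℝ × ℝ → (ℝ × ℝ × ℝ) →L[ℝ] ℂ :=
  contourExponent (RingHom.id ℂ)
    (Complex.ofRealCLM.comp (ContinuousLinearMap.fst ℝ ℝ (ℝ × ℝ)))
    (Complex.ofRealCLM.comp ((ContinuousLinearMap.fst ℝ ℝ ℝ).comp
      (ContinuousLinearMap.snd ℝ ℝ (ℝ × ℝ))))
    (Complex.ofRealCLM.comp ((ContinuousLinearMap.snd ℝ ℝ ℝ).comp
      (ContinuousLinearMap.snd ℝ ℝ (ℝ × ℝ))))

theorem integrable_contourWeight_mul_exp (t x y : ℝ) :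
    Integrable (fun p => contourWeight p *
      Complex.exp (exponentT p * t + pointV p * x - pointU p * y)) contourMeasure := by
  have h := expIntegrable_contourWeight.integrable_mul_exp
    (gaugeBounded_contourExponent (fun _ => rfl) _ _ _ : GaugeBounded _ _ scalarExponent) (t, x, y)
  simpa [scalarExponent, contourExponent_apply, ← Complex.exp_eq_exp_ℂ] using h

theorem contourWeight_mul_exp (t x y : ℝ) (p : Fin 4 × ℝ × ℝ) :
    contourWeight p * Complex.exp (exponentT p * t + pointV p * x - pointU p * y) =
      -(1 / (4 * (Real.pi : ℂ) ^ 2)) * raySign p.1 *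
        (pearceyIntegrand t t x y (p.2.1 * rayDir p.1) (p.2.2 * Complex.I) * Complex.I *
          rayDir p.1) := by
  have h1 : Complex.exp (-(pointU p ^ 4 / 4) + t * pointU p ^ 2 / 2 - pointU p * y) =
      Complex.exp (-(pointU p ^ 4 / 4)) * Complex.exp (t * pointU p ^ 2 / 2 - pointU p * y) := by
    rw [← Complex.exp_add]; ring_nf
  have h2 : Complex.exp (pointV p ^ 4 / 4 - t * pointV p ^ 2 / 2 + pointV p * x) =
      Complex.exp (pointV p ^ 4 / 4) * Complex.exp (-(t * pointV p ^ 2 / 2) + pointV p * x) := by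
    rw [← Complex.exp_add]; ring_nf
  have h3 : Complex.exp (exponentT p * t + pointV p * x - pointU p * y) =
      Complex.exp (t * pointU p ^ 2 / 2 - pointU p * y) *
        Complex.exp (-(t * pointV p ^ 2 / 2) + pointV p * x) := by
    rw [← Complex.exp_add, exponentT]; ring_nf
  rw [contourWeight, baseWeight, h3, pearceyIntegrand, ← pointV, ← pointU, h1, h2]
  ring

theorem pearceyContour_eq_integral (t x y : ℝ) :
    pearceyContour t t x y = ∫ p, contourWeight p *
      Complex.exp (exponentT p * t + pointV p * x - pointU p * y) ∂contourMeasure := by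
  have hint := integrable_contourWeight_mul_exp t x y
  rw [contourMeasure, integral_prod _ hint, integral_count]
  have hi : ∀ i : Fin 4, Integrable (fun q : ℝ × ℝ => contourWeight (i, q) *
      Complex.exp (exponentT (i, q) * t + pointV (i, q) * x - pointU (i, q) * y))
      ((volume.restrict (Set.Ioi 0)).prod volume) := by
    have := hint.prod_right_ae
    rw [Measure.ae_count_iff] at this
    exact this
  have hJ : ∀ i : Fin 4, ∫ q : ℝ × ℝ, contourWeight (i, q) *
      Complex.exp (exponentT (i, q) * t + pointV (i, q) * x - pointU (i, q) * y)
      ∂((volume.restrict (Set.Ioi 0)).prod volume) =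
      -(1 / (4 * (Real.pi : ℂ) ^ 2)) * raySign i * ∫ ρ in Set.Ioi (0 : ℝ),
        integralIm (fun U => pearceyIntegrand t t x y (ρ * rayDir i) U) * rayDir i := by
    intro i
    rw [integral_prod _ (hi i), ← integral_const_mul]
    refine integral_congr_ae (Filter.Eventually.of_forall fun ρ => ?_)
    simp only [contourWeight_mul_exp, integralIm]
    rw [integral_const_mul, integral_mul_const]
  simp only [hJ, Fin.sum_univ_four, pearceyContour, integralX]
  simp [rayDir, raySign]
  ring

end KernelFormula

/-! ### Moments of the double contour integral -/

section Moments

theorem ExpIntegrable.mul_of_norm_le {Ω 𝔸 : Type*} [MeasurableSpace Ω] {μ : Measure Ω}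
    [NormedCommRing 𝔸] [NormedAlgebra ℝ 𝔸] {g : Ω → ℝ} {W m : Ω → 𝔸} (hW : ExpIntegrable μ g W)
    (hg : AEStronglyMeasurable g μ) (hm : AEStronglyMeasurable m μ) (hb : ∀ ω, ‖m ω‖ ≤ g ω) :
    ExpIntegrable μ g (fun ω => W ω * m ω) := by
  have h : GaugeBounded μ g (fun ω => mulComp (m ω) (ContinuousLinearMap.id ℝ 𝔸)) := by
    refine ⟨(continuous_mulComp.comp (continuous_id.prodMk continuous_const)
      ).comp_aestronglyMeasurable hm, hg, 1, fun ω => ?_⟩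
    refine (norm_mulComp_le _ _).trans ?_
    have h1 := ContinuousLinearMap.norm_id_le (𝕜 := ℝ) (E := 𝔸)
    rw [one_mul]
    exact (mul_le_of_le_one_right (norm_nonneg _) h1).trans (hb ω)
  simpa [mulComp] using hW.mul_apply h (1 : 𝔸)

/-- The moments `∫ V^j U^k` of the double contour integral. -/
noncomputable def contourMoment (j k : ℕ) : ℂ :=
  ∫ p, baseWeight p * pointV p ^ j * pointU p ^ k ∂contourMeasure

/-- The weight is kept as `contourWeight * (U - V)`, almost everywhere equal to `baseWeight`, so
that integrability is inherited from `contourWeight`. -/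
theorem expIntegrable_baseWeight_mul (j k : ℕ) :
    ExpIntegrable contourMeasure contourGauge
      (fun p => contourWeight p * (pointU p - pointV p) * pointV p ^ j * pointU p ^ k) := by
  have hg := measurable_contourGauge.aestronglyMeasurable (μ := contourMeasure)
  have hV : ∀ {W : Fin 4 × ℝ × ℝ → ℂ}, ExpIntegrable contourMeasure contourGauge W →
      ExpIntegrable contourMeasure contourGauge (fun p => W p * pointV p) := fun h =>
    h.mul_of_norm_le hg measurable_pointV.aestronglyMeasurable norm_pointV_le
  have hU : ∀ {W : Fin 4 × ℝ × ℝ → ℂ}, ExpIntegrable contourMeasure contourGauge W →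
      ExpIntegrable contourMeasure contourGauge (fun p => W p * pointU p) := fun h =>
    h.mul_of_norm_le hg measurable_pointU.aestronglyMeasurable norm_pointU_le
  induction k with
  | zero =>
    induction j with
    | zero =>
      have h := (hU expIntegrable_contourWeight)
      have h' := (hV expIntegrable_contourWeight)
      refine ⟨by fun_prop, fun R => ?_⟩
      refine ((h.integrable R).add (h'.integrable R)).mono' (by fun_prop) ?_
      filter_upwards with p
      simp only [pow_zero, mul_one, Pi.add_apply]
      rw [Real.norm_of_nonneg (by positivity), ← add_mul, mul_sub]
      gcongr
      exact norm_sub_le _ _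
    | succ j ih => simpa [pow_succ, mul_assoc] using hV ih
  | succ k ih => simpa [pow_succ, mul_assoc] using hU ih

theorem contourWeight_mul_sub {p : Fin 4 × ℝ × ℝ} (hp : 0 < p.2.1) :
    contourWeight p * (pointU p - pointV p) = baseWeight p := by
  rw [contourWeight, mul_assoc, one_div_mul_cancel (sub_ne_zero.2 (pointU_ne_pointV hp)), mul_one]

theorem integrable_baseWeight_mul (j k : ℕ) :
    Integrable (fun p => baseWeight p * pointV p ^ j * pointU p ^ k) contourMeasure := by
  have h := (expIntegrable_baseWeight_mul j k).integrable 0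
  simp only [zero_mul, Real.exp_zero, mul_one] at h
  rw [integrable_norm_iff (by fun_prop)] at h
  refine h.congr ?_
  filter_upwards [ae_contourMeasure] with p hp
  rw [contourWeight_mul_sub hp.1]

/-- Since `rayDir ^ 4 = -1` on every ray, the exponentials depend on `ρ` and `u` alone, and the ray
enters only through a finite sum. -/
theorem contourMoment_eq (j k : ℕ) : contourMoment j k =
    -(1 / (4 * (Real.pi : ℂ) ^ 2)) * Complex.I ^ (k + 1) * (∑ i, raySign i * rayDir i ^ (j + 1)) *
      ((∫ ρ in Set.Ioi (0 : ℝ), ρ ^ j * Real.exp (-(ρ ^ 4 / 4)) : ℝ) *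
        (∫ u : ℝ, u ^ k * Real.exp (-(u ^ 4 / 4)) : ℝ)) := by
  have h : ∀ p : Fin 4 × ℝ × ℝ, baseWeight p * pointV p ^ j * pointU p ^ k =
      (-(1 / (4 * (Real.pi : ℂ) ^ 2)) * Complex.I ^ (k + 1) *
        (raySign p.1 * rayDir p.1 ^ (j + 1))) *
      (((p.2.1 ^ j * Real.exp (-(p.2.1 ^ 4 / 4)) : ℝ) : ℂ) *
        ((p.2.2 ^ k * Real.exp (-(p.2.2 ^ 4 / 4)) : ℝ) : ℂ)) := by
    intro p
    rw [baseWeight, pointU_pow_four, pointV_pow_four, pointU, pointV]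
    push_cast
    rw [neg_div]
    ring
  simp only [contourMoment, h, contourMeasure]
  rw [integral_prod_mul (μ := Measure.count)
    (ν := (volume.restrict (Set.Ioi (0 : ℝ))).prod (volume : Measure ℝ))
    (fun i : Fin 4 => -(1 / (4 * (Real.pi : ℂ) ^ 2)) * Complex.I ^ (k + 1) *
        (raySign i * rayDir i ^ (j + 1)))
    (fun q : ℝ × ℝ => ((q.1 ^ j * Real.exp (-(q.1 ^ 4 / 4)) : ℝ) : ℂ) *
        ((q.2 ^ k * Real.exp (-(q.2 ^ 4 / 4)) : ℝ) : ℂ)),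
    integral_prod_mul (μ := volume.restrict (Set.Ioi (0 : ℝ))) (ν := (volume : Measure ℝ))
    (fun x : ℝ => ((x ^ j * Real.exp (-(x ^ 4 / 4)) : ℝ) : ℂ))
    (fun x : ℝ => ((x ^ k * Real.exp (-(x ^ 4 / 4)) : ℝ) : ℂ)),
    integral_count, ← Finset.mul_sum, integral_complex_ofReal,
    integral_complex_ofReal]

/-- Opposite rays carry the same sign, so odd powers of their directions cancel. -/
theorem contourMoment_eq_zero_of_even {j : ℕ} (hj : Even j) (k : ℕ) : contourMoment j k = 0 := by
  have : ∑ i, raySign i * rayDir i ^ (j + 1) = 0 := by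
    simp [Fin.sum_univ_four, raySign, rayDir, hj.add_one.neg_pow]
  rw [contourMoment_eq, this]
  simp

theorem contourMoment_three (k : ℕ) : contourMoment 3 k = 0 := by
  have : ∑ i, raySign i * rayDir i ^ (3 + 1) = 0 := by
    simp [rayDir_pow_four, Fin.sum_univ_four, raySign]
  rw [contourMoment_eq, this]
  simp

theorem contourMoment_one_one : contourMoment 1 1 = 0 := by
  have h := integral_neg_eq_self (fun u : ℝ => u ^ 1 * Real.exp (-(u ^ 4 / 4))) volume
  have h' : ∫ u : ℝ, u ^ 1 * Real.exp (-(u ^ 4 / 4)) = 0 := by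
    simp only [pow_one, neg_mul, integral_neg, Even.neg_pow (show Even 4 by decide)] at h ⊢
    linarith
  rw [contourMoment_eq, h']
  simp

theorem integral_pow_mul_exp_quartic_pos (j : ℕ) :
    0 < ∫ ρ in Set.Ioi (0 : ℝ), ρ ^ j * Real.exp (-(ρ ^ 4 / 4)) := by
  have h := integral_rpow_mul_exp_neg_mul_rpow (p := 4) (q := j) (b := 1 / 4) (by norm_num)
    (by have : (0 : ℝ) ≤ j := j.cast_nonneg
        linarith) (by norm_num)
  have h2 : ∫ ρ in Set.Ioi (0 : ℝ), ρ ^ j * Real.exp (-(ρ ^ 4 / 4)) =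
      ∫ x in Set.Ioi (0 : ℝ), x ^ (j : ℝ) * Real.exp (-(1 / 4) * x ^ (4 : ℝ)) := by
    refine setIntegral_congr_fun measurableSet_Ioi fun x hx => ?_
    have : x ^ (4 : ℝ) = x ^ 4 := by exact_mod_cast Real.rpow_natCast x 4
    simp only [Real.rpow_natCast, this]
    ring_nf
  rw [h2, h]
  have := Real.Gamma_pos_of_pos (s := ((j : ℝ) + 1) / 4) (by positivity)
  positivity

/-- Signs times squared directions equal `-i` on all four rays, so nothing cancels; the moment is
`2ab / π²` with `a`, `b` positive quartic integrals. -/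
theorem contourMoment_one_two_pos : 0 < (contourMoment 1 2).re := by
  have hs : ∑ i, raySign i * rayDir i ^ (1 + 1) = -4 * Complex.I := by
    simp [Fin.sum_univ_four, raySign, rayDir, pearceyOmega_sq, conj_pearceyOmega_sq]
    ring
  have hb : ∫ u : ℝ, u ^ 2 * Real.exp (-(u ^ 4 / 4)) =
      2 * ∫ ρ in Set.Ioi (0 : ℝ), ρ ^ 2 * Real.exp (-(ρ ^ 4 / 4)) := by
    rw [← integral_comp_abs]
    simp only [sq_abs, Even.pow_abs (show Even 4 by decide)]
  have h1 := integral_pow_mul_exp_quartic_pos 1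
  have h2 := integral_pow_mul_exp_quartic_pos 2
  rw [contourMoment_eq, hs, hb]
  set a := ∫ ρ in Set.Ioi (0 : ℝ), ρ ^ 1 * Real.exp (-(ρ ^ 4 / 4))
  set b := ∫ ρ in Set.Ioi (0 : ℝ), ρ ^ 2 * Real.exp (-(ρ ^ 4 / 4))
  have : -(1 / (4 * (Real.pi : ℂ) ^ 2)) * Complex.I ^ (2 + 1) * (-4 * Complex.I) *
      ((a : ℂ) * ((2 * b : ℝ) : ℂ)) = ((2 * a * b / Real.pi ^ 2 : ℝ) : ℂ) := by
    have hpi : (Real.pi : ℂ) ≠ 0 := Complex.ofReal_ne_zero.2 Real.pi_ne_zero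
    push_cast
    rw [show -(1 / (4 * (Real.pi : ℂ) ^ 2)) * Complex.I ^ (2 + 1) * (-4 * Complex.I) *
      ((a : ℂ) * (2 * b)) = (1 / (Real.pi : ℂ) ^ 2) * (Complex.I ^ 4) * (2 * a * b) by
        field_simp, Complex.I_pow_four]
    ring
  rw [this, Complex.ofReal_re]
  positivity

end Moments

/-! ### Iterated directional derivatives -/

section DirectionalDerivatives

variable {E E' F G : Type*} [NormedAddCommGroup E] [NormedSpace ℝ E]
  [NormedAddCommGroup E'] [NormedSpace ℝ E'] [NormedAddCommGroup F] [NormedSpace ℝ F]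
  [NormedAddCommGroup G] [NormedSpace ℝ G]

/-- The iterated directional derivative `∂_{v₁} ∂_{v₂} ⋯ f` along a list of directions. -/
noncomputable def dirDerivs : List E → (E → F) → E → F
  | [], f => f
  | v :: l, f => fun z => fderiv ℝ (dirDerivs l f) z v

theorem ContDiffOn.dirDerivs {f : E → F} {U : Set E} (hU : IsOpen U)
    (hf : ContDiffOn ℝ (⊤ : ℕ∞) f U) (l : List E) :
    ContDiffOn ℝ (⊤ : ℕ∞) (dirDerivs l f) U := by
  induction l with
  | nil => exact hf
  | cons v l ih =>
    exact (ih.fderiv_of_isOpen (m := (⊤ : ℕ∞)) hU (by simp)).clm_apply contDiffOn_const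

theorem dirDerivs_congr {f g : E → F} {U : Set E} (hU : IsOpen U) (h : Set.EqOn f g U)
    (l : List E) : Set.EqOn (dirDerivs l f) (dirDerivs l g) U := by
  induction l with
  | nil => exact h
  | cons v l ih =>
    intro z hz
    have : dirDerivs l f =ᶠ[nhds z] dirDerivs l g := ih.eventuallyEq_of_mem (hU.mem_nhds hz)
    simp only [dirDerivs, this.fderiv_eq]

theorem dirDerivs_zero (l : List E) : dirDerivs l (fun _ => (0 : F)) = fun _ => 0 := by
  induction l with
  | nil => rfl
  | cons v l ih => simp [dirDerivs, ih]

theorem ContDiffOn.differentiableAt_of_isOpen {f : E → F} {U : Set E} (hU : IsOpen U)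
    (hf : ContDiffOn ℝ (⊤ : ℕ∞) f U) {z : E} (hz : z ∈ U) : DifferentiableAt ℝ f z :=
  (hf.contDiffAt (hU.mem_nhds hz)).differentiableAt (by simp)

theorem dirDerivs_append_singleton (l : List E) (v : E) (f : E → F) :
    dirDerivs (l ++ [v]) f = dirDerivs l (dirDerivs [v] f) := by
  induction l with
  | nil => rfl
  | cons w l ih => simp only [List.cons_append, dirDerivs, ih]

theorem dirDerivs_swap {f : E → F} {U : Set E} (hU : IsOpen U)
    (hf : ContDiffOn ℝ (⊤ : ℕ∞) f U) (v w : E) :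
    Set.EqOn (dirDerivs [v, w] f) (dirDerivs [w, v] f) U := by
  intro z hz
  have h := hf.contDiffAt (hU.mem_nhds hz)
  have hs : IsSymmSndFDerivAt ℝ f z := h.isSymmSndFDerivAt (by
    rw [minSmoothness_of_isRCLikeNormedField]
    exact WithTop.coe_le_coe.2 (le_top : (2 : ℕ∞) ≤ ⊤))
  have hd : DifferentiableAt ℝ (fderiv ℝ f) z :=
    (hf.fderiv_of_isOpen (m := (⊤ : ℕ∞)) hU (by simp)).differentiableAt_of_isOpen hU hz
  simp only [dirDerivs]
  rw [fderiv_clm_apply hd (differentiableAt_const _),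
    fderiv_clm_apply hd (differentiableAt_const _)]
  simpa using hs v w

theorem dirDerivs_cons_eq_append {f : E → F} {U : Set E} (hU : IsOpen U)
    (hf : ContDiffOn ℝ (⊤ : ℕ∞) f U) (v : E) (l : List E) :
    Set.EqOn (dirDerivs (v :: l) f) (dirDerivs (l ++ [v]) f) U := by
  induction l with
  | nil => intro z _; rfl
  | cons w l ih =>
    intro z hz
    have h1 := dirDerivs_swap hU (hf.dirDerivs hU l) v w hz
    exact h1.trans (dirDerivs_congr hU ih [w] hz)

theorem dirDerivs_comp_clm {f : E → F} {U : Set E} (hU : IsOpen U)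
    (hf : ContDiffOn ℝ (⊤ : ℕ∞) f U) (ι : E' →L[ℝ] E) (l : List E') :
    Set.EqOn (dirDerivs l (f ∘ ι)) (dirDerivs (l.map ι) f ∘ ι) (ι ⁻¹' U) := by
  induction l with
  | nil => intro z _; rfl
  | cons v l ih =>
    intro z hz
    have h1 := dirDerivs_congr (hU.preimage ι.continuous) ih [v] hz
    refine h1.trans ?_
    have h2 : DifferentiableAt ℝ (dirDerivs (l.map ι) f) (ι z) :=
      (hf.dirDerivs hU _).differentiableAt_of_isOpen hU hz
    simp only [dirDerivs, List.map_cons, Function.comp_apply]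
    rw [fderiv_comp z h2 ι.differentiableAt]
    simp

theorem dirDerivs_clm_comp {f : E → F} {U : Set E} (hU : IsOpen U)
    (hf : ContDiffOn ℝ (⊤ : ℕ∞) f U) (L : F →L[ℝ] G) (l : List E) :
    Set.EqOn (dirDerivs l (L ∘ f)) (L ∘ dirDerivs l f) U := by
  induction l with
  | nil => intro z _; rfl
  | cons v l ih =>
    intro z hz
    have h1 := dirDerivs_congr hU ih [v] hz
    refine h1.trans ?_
    have h2 := (hf.dirDerivs hU l).differentiableAt_of_isOpen hU hz
    simp only [dirDerivs, Function.comp_apply]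
    rw [fderiv_comp z L.differentiableAt h2]
    simp

/-- If `f` vanishes along the image of `ι`, the derivative in a direction `a` at `0` of a derivative
of `f` tangential to the image of `ι` is the tangential derivative of `∂_a f`. -/
theorem hasDerivAt_dirDerivs_smul {f : E → F} {U : Set E} (hU : IsOpen U)
    (hf : ContDiffOn ℝ (⊤ : ℕ∞) f U) (h0 : (0 : E) ∈ U) (ι : E' →L[ℝ] E) (a : E) {g : E' → F}
    (hg : ∀ z, ι z ∈ U → fderiv ℝ f (ι z) a = g z) (l : List E') :
    HasDerivAt (fun ε : ℝ => dirDerivs (l.map ι) f (ε • a)) (dirDerivs l g 0) 0 := by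
  have h1 : dirDerivs l g 0 = dirDerivs (a :: l.map ι) f 0 := by
    have h2 : Set.EqOn (dirDerivs [a] f ∘ ι) g (ι ⁻¹' U) := fun z hz => hg z hz
    have h3 : (0 : E') ∈ ι ⁻¹' U := by simpa using h0
    -- Symmetry of derivatives moves `a` to the innermost place, where `∂_a f` is known along the
    -- image of `ι`; the remaining derivatives are tangential and see only that restriction.
    rw [dirDerivs_cons_eq_append hU hf a _ h0, dirDerivs_append_singleton,
      ← dirDerivs_congr (hU.preimage ι.continuous) h2 l h3,
      dirDerivs_comp_clm hU (hf.dirDerivs hU [a]) ι l h3]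
    simp
  have h4 : HasFDerivAt (dirDerivs (l.map ι) f) (fderiv ℝ (dirDerivs (l.map ι) f) 0)
      ((0 : ℝ) • a) := by
    rw [zero_smul]
    exact ((hf.dirDerivs hU _).differentiableAt_of_isOpen hU h0).hasFDerivAt
  have h5 := h4.comp_hasDerivAt (0 : ℝ) ((hasDerivAt_id (0 : ℝ)).smul_const a)
  rw [one_smul] at h5
  rw [h1]
  exact h5

theorem dirDerivs_eq_zero_of_comp {f : E → F} {U : Set E} (hU : IsOpen U)
    (hf : ContDiffOn ℝ (⊤ : ℕ∞) f U) (h0 : (0 : E) ∈ U) (ι : E' →L[ℝ] E)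
    (hz : ∀ z, ι z ∈ U → f (ι z) = 0) (l : List E') : dirDerivs (l.map ι) f 0 = 0 := by
  have h3 : (0 : E') ∈ ι ⁻¹' U := by simpa using h0
  have h1 := dirDerivs_comp_clm hU hf ι l h3
  have h2 : Set.EqOn (f ∘ ι) (fun _ => 0) (ι ⁻¹' U) := fun z h => hz z h
  rw [dirDerivs_congr (hU.preimage ι.continuous) h2 l h3, dirDerivs_zero] at h1
  simpa using h1.symm

end DirectionalDerivatives

/-! ### Derivatives of the density at the origin -/

section Density

/-- The density `K_{t,t}(h,h)` of the Pearcey process as a function of `(t,h)`. -/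
noncomputable def pearceyDensity (z : ℝ × ℝ) : ℝ := pearceyKernel z.1 z.1 z.2 z.2

/-- The exponent of the density as a linear function of `(t,h)`. -/
noncomputable def densityExponent : Fin 4 × ℝ × ℝ → (ℝ × ℝ) →L[ℝ] ℂ :=
  contourExponent (RingHom.id ℂ)
    (Complex.ofRealCLM.comp (ContinuousLinearMap.fst ℝ ℝ ℝ))
    (Complex.ofRealCLM.comp (ContinuousLinearMap.snd ℝ ℝ ℝ))
    (Complex.ofRealCLM.comp (ContinuousLinearMap.snd ℝ ℝ ℝ))

theorem densityExponent_apply (p : Fin 4 × ℝ × ℝ) (z : ℝ × ℝ) :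
    densityExponent p z = exponentT p * z.1 + pointV p * z.2 - pointU p * z.2 := rfl

theorem pearceyKernel_self (t x y : ℝ) : pearceyKernel t t x y = (pearceyContour t t x y).re := by
  simp [pearceyKernel]

theorem pearceyDensity_eq :
    pearceyDensity = Complex.reCLM ∘ expIntegral contourMeasure densityExponent contourWeight := by
  funext z
  rw [pearceyDensity, pearceyKernel_self, pearceyContour_eq_integral]
  simp [expIntegral, densityExponent_apply, ← Complex.exp_eq_exp_ℂ]

theorem gaugeBounded_densityExponent :
    GaugeBounded contourMeasure contourGauge densityExponent :=
  gaugeBounded_contourExponent (fun _ => rfl) _ _ _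

theorem dirDerivs_expIntegral (l : List (ℝ × ℝ)) :
    ∃ W, ExpIntegrable contourMeasure contourGauge W ∧
      dirDerivs l (expIntegral contourMeasure densityExponent contourWeight) =
        expIntegral contourMeasure densityExponent W ∧
      W = fun p => contourWeight p * (l.map (densityExponent p)).prod := by
  induction l with
  | nil => exact ⟨_, expIntegrable_contourWeight, rfl, by simp⟩
  | cons v l ih =>
    obtain ⟨W, hW, h, h'⟩ := ih
    refine ⟨_, hW.mul_apply gaugeBounded_densityExponent v, ?_, ?_⟩
    · funext z
      simp only [dirDerivs, h]
      exact hW.fderiv_apply gaugeBounded_densityExponent z v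
    · funext p
      simp only [h', List.map_cons, List.prod_cons]
      ring

theorem contDiff_pearceyDensity : ContDiff ℝ (⊤ : ℕ∞) pearceyDensity := by
  rw [pearceyDensity_eq]
  exact Complex.reCLM.contDiff.comp
    (expIntegrable_contourWeight.contDiff gaugeBounded_densityExponent)

theorem dirDerivs_pearceyDensity_zero (l : List (ℝ × ℝ)) :
    dirDerivs l pearceyDensity 0 =
      (∫ p, contourWeight p * (l.map (densityExponent p)).prod ∂contourMeasure).re := by
  obtain ⟨W, -, h, h'⟩ := dirDerivs_expIntegral l
  rw [pearceyDensity_eq, dirDerivs_clm_comp isOpen_univ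
    (expIntegrable_contourWeight.contDiff gaugeBounded_densityExponent).contDiffOn _ l
    (Set.mem_univ _), Function.comp_apply, h]
  simp [expIntegral, h']

theorem integral_moments_three (a b c : ℂ) :
    ∫ p, (a * (baseWeight p * pointV p ^ 2 * pointU p ^ 0) +
      b * (baseWeight p * pointV p ^ 1 * pointU p ^ 1) +
      c * (baseWeight p * pointV p ^ 0 * pointU p ^ 2)) ∂contourMeasure = 0 := by
  have i := fun (e : ℂ) j k => (integrable_baseWeight_mul j k).const_mul e
  have hM : ∀ j k, ∫ p, baseWeight p * pointV p ^ j * pointU p ^ k ∂contourMeasure =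
      contourMoment j k := fun _ _ => rfl
  refine (integral_add ((i a 2 0).add (i b 1 1)) (i c 0 2)).trans ?_
  rw [integral_add' (i a 2 0) (i b 1 1)]
  simp only [integral_const_mul, hM, contourMoment_one_one,
    contourMoment_eq_zero_of_even (show Even 2 by decide),
    contourMoment_eq_zero_of_even (show Even 0 by decide)]
  simp

/-- Among the cubic moments only that of `V U²` survives, so each fourth-order computation reduces
to reading off one coefficient. -/
theorem integral_moments_four (a b c d : ℂ) :
    ∫ p, (a * (baseWeight p * pointV p ^ 3 * pointU p ^ 0) +
      b * (baseWeight p * pointV p ^ 2 * pointU p ^ 1) +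
      c * (baseWeight p * pointV p ^ 1 * pointU p ^ 2) +
      d * (baseWeight p * pointV p ^ 0 * pointU p ^ 3)) ∂contourMeasure =
    c * contourMoment 1 2 := by
  have i := fun (e : ℂ) j k => (integrable_baseWeight_mul j k).const_mul e
  have hM : ∀ j k, ∫ p, baseWeight p * pointV p ^ j * pointU p ^ k ∂contourMeasure =
      contourMoment j k := fun _ _ => rfl
  refine (integral_add (((i a 3 0).add (i b 2 1)).add (i c 1 2)) (i d 0 3)).trans ?_
  rw [integral_add' ((i a 3 0).add (i b 2 1)) (i c 1 2), integral_add' (i a 3 0) (i b 2 1)]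
  simp only [integral_const_mul, hM, contourMoment_three,
    contourMoment_eq_zero_of_even (show Even 2 by decide),
    contourMoment_eq_zero_of_even (show Even 0 by decide)]
  simp

/-- The integrand becomes `(V - U)³ / (U - V) = -(V - U)²`, and all quadratic moments vanish. -/
theorem dirDerivs_pearceyDensity_space_three :
    dirDerivs [(0, 1), (0, 1), (0, 1)] pearceyDensity 0 = 0 := by
  have h : ∫ p, contourWeight p *
      (([(0, 1), (0, 1), (0, 1)] : List (ℝ × ℝ)).map (densityExponent p)).prod ∂contourMeasure =
      ∫ p, (-1 * (baseWeight p * pointV p ^ 2 * pointU p ^ 0) +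
        2 * (baseWeight p * pointV p ^ 1 * pointU p ^ 1) +
        (-1) * (baseWeight p * pointV p ^ 0 * pointU p ^ 2)) ∂contourMeasure := by
    refine integral_congr_ae ?_
    filter_upwards [ae_contourMeasure] with p hp
    simp only [List.map_cons, List.map_nil, List.prod_cons, List.prod_nil, densityExponent_apply,
      ← contourWeight_mul_sub hp.1]
    push_cast
    ring
  rw [dirDerivs_pearceyDensity_zero, h, integral_moments_three, Complex.zero_re]

/-- Here `(V - U)⁴ / (U - V) = -(V - U)³`, where `V U²` has coefficient `-3`. -/
theorem dirDerivs_pearceyDensity_space_four :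
    dirDerivs [(0, 1), (0, 1), (0, 1), (0, 1)] pearceyDensity 0 = -3 * (contourMoment 1 2).re := by
  have h : ∫ p, contourWeight p *
      (([(0, 1), (0, 1), (0, 1), (0, 1)] : List (ℝ × ℝ)).map (densityExponent p)).prod
        ∂contourMeasure =
      ∫ p, (-1 * (baseWeight p * pointV p ^ 3 * pointU p ^ 0) +
        3 * (baseWeight p * pointV p ^ 2 * pointU p ^ 1) +
        (-3) * (baseWeight p * pointV p ^ 1 * pointU p ^ 2) +
        1 * (baseWeight p * pointV p ^ 0 * pointU p ^ 3)) ∂contourMeasure := by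
    refine integral_congr_ae ?_
    filter_upwards [ae_contourMeasure] with p hp
    simp only [List.map_cons, List.map_nil, List.prod_cons, List.prod_nil, densityExponent_apply,
      ← contourWeight_mul_sub hp.1]
    push_cast
    ring
  rw [dirDerivs_pearceyDensity_zero, h, integral_moments_four]
  simp

/-- The time derivative brings down `(U² - V²) / 2`, giving `(U + V)(U - V)² / 2`, where `V U²` has
coefficient `-1/2`. -/
theorem dirDerivs_pearceyDensity_time :
    dirDerivs [(1, 0), (0, 1), (0, 1)] pearceyDensity 0 = -(1 / 2) * (contourMoment 1 2).re := by
  have h : ∫ p, contourWeight p *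
      (([(1, 0), (0, 1), (0, 1)] : List (ℝ × ℝ)).map (densityExponent p)).prod ∂contourMeasure =
      ∫ p, (1 / 2 * (baseWeight p * pointV p ^ 3 * pointU p ^ 0) +
        (-(1 / 2)) * (baseWeight p * pointV p ^ 2 * pointU p ^ 1) +
        (-(1 / 2)) * (baseWeight p * pointV p ^ 1 * pointU p ^ 2) +
        1 / 2 * (baseWeight p * pointV p ^ 0 * pointU p ^ 3)) ∂contourMeasure := by
    refine integral_congr_ae ?_
    filter_upwards [ae_contourMeasure] with p hp
    simp only [List.map_cons, List.map_nil, List.prod_cons, List.prod_nil, densityExponent_apply,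
      ← contourWeight_mul_sub hp.1, exponentT]
    push_cast
    ring
  rw [dirDerivs_pearceyDensity_zero, h, integral_moments_four]
  simp

end Density

/-! ### Transport of the determinant to a fixed parameter space -/

section ChangeOfVariables

theorem pi_withDensity_ofReal {X : Type*} [MeasurableSpace X] (μ : Measure X) [IsFiniteMeasure μ]
    {w : X → ℝ} (hw : Integrable w μ) (h0 : ∀ x, 0 ≤ w x) (n : ℕ) :
    Measure.pi (fun _ : Fin n => μ.withDensity fun x => ENNReal.ofReal (w x)) =
      (Measure.pi fun _ : Fin n => μ).withDensity
        (fun x => ENNReal.ofReal (∏ i, w (x i))) := by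
  have : IsFiniteMeasure (μ.withDensity fun x => ENNReal.ofReal (w x)) :=
    isFiniteMeasure_withDensity_ofReal hw.2
  refine Measure.pi_eq fun s hs => ?_
  rw [withDensity_apply _ (MeasurableSet.univ_pi hs), Measure.restrict_pi_pi,
    ← ofReal_integral_eq_lintegral_ofReal, integral_fintype_prod_eq_prod (fun _ => w),
    ENNReal.ofReal_prod_of_nonneg]
  · refine Finset.prod_congr rfl fun i _ => ?_
    rw [withDensity_apply _ (hs i), ofReal_integral_eq_lintegral_ofReal hw.restrict
      (Filter.Eventually.of_forall h0)]
  · exact fun i _ => integral_nonneg h0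
  · exact Integrable.fintype_prod (f := fun _ => w) fun i => hw.restrict
  · exact Filter.Eventually.of_forall fun x => Finset.prod_nonneg fun i _ => h0 _

/-- The parameter space of a union of `r` intervals. -/
abbrev IntervalParam (r : ℕ) : Type := Fin r × unitInterval

/-- The measure on the parameter space of a union of intervals. -/
noncomputable def paramMeasure (r : ℕ) : Measure (IntervalParam r) :=
  Measure.count.prod volume

instance (r : ℕ) : IsFiniteMeasure (paramMeasure r) := by
  unfold paramMeasure
  infer_instance

variable {r : ℕ}

/-- The left endpoint of the `i`-th interval. -/
def leftEnd (y : Fin (2 * r) → ℝ) (i : Fin r) : ℝ := y ⟨2 * i.val, by omega⟩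

/-- The right endpoint of the `i`-th interval. -/
def rightEnd (y : Fin (2 * r) → ℝ) (i : Fin r) : ℝ := y ⟨2 * i.val + 1, by omega⟩

/-- The length of the interval on which a parameter lies. -/
def paramWidth (y : Fin (2 * r) → ℝ) (q : IntervalParam r) : ℝ := rightEnd y q.1 - leftEnd y q.1

/-- The affine parametrization of the intervals. -/
def paramPoint (y : Fin (2 * r) → ℝ) (q : IntervalParam r) : ℝ :=
  leftEnd y q.1 + q.2 * paramWidth y q

theorem continuous_paramWidth (y : Fin (2 * r) → ℝ) : Continuous (paramWidth y) := by
  have h : Continuous fun i : Fin r => rightEnd y i - leftEnd y i := continuous_of_discreteTopology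
  exact h.comp continuous_fst

theorem continuous_paramPoint (y : Fin (2 * r) → ℝ) : Continuous (paramPoint y) := by
  have h : Continuous (leftEnd y) := continuous_of_discreteTopology
  exact (h.comp continuous_fst).add
    ((continuous_subtype_val.comp continuous_snd).mul (continuous_paramWidth y))

theorem leftEnd_lt_rightEnd {y : Fin (2 * r) → ℝ} (hy : StrictMono y) (i : Fin r) :
    leftEnd y i < rightEnd y i :=
  hy (by simp [Fin.lt_def])

theorem volume_affine_preimage (a b : ℝ) (hab : a < b) (s : Set ℝ) :
    ENNReal.ofReal (b - a) * volume {u : unitInterval | a + u * (b - a) ∈ s} =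
      volume (s ∩ Set.Ioo a b) := by
  have hw : 0 < b - a := sub_pos.2 hab
  have h1 : (Subtype.val '' {u : unitInterval | a + u * (b - a) ∈ s} : Set ℝ) =
      (fun u => (b - a) * u) ⁻¹' ((fun x => a + x) ⁻¹' (s ∩ Set.Icc a b)) := by
    ext u
    simp only [Set.mem_image, Set.mem_ofPred_eq, Set.mem_preimage, Set.mem_inter_iff, Set.mem_Icc,
      Subtype.exists, exists_and_right, exists_eq_right, mul_comm (b - a) u]
    constructor
    · rintro ⟨hu, h⟩
      exact ⟨h, by nlinarith [hu.1], by nlinarith [hu.2]⟩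
    · rintro ⟨h, h2, h3⟩
      refine ⟨⟨?_, ?_⟩, h⟩
      · by_contra hc
        nlinarith [not_le.1 hc]
      · by_contra hc
        nlinarith [not_le.1 hc]
  rw [unitInterval.volume_apply, h1, Real.volume_preimage_mul_left hw.ne', measure_preimage_add,
    ← mul_assoc, ← ENNReal.ofReal_mul hw.le, abs_of_pos (inv_pos.2 hw), mul_inv_cancel₀ hw.ne',
    ENNReal.ofReal_one, one_mul]
  exact measure_congr ((Filter.EventuallyEq.refl _ s).inter Ioo_ae_eq_Icc.symm)

theorem map_paramPoint {y : Fin (2 * r) → ℝ} (hy : StrictMono y) :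
    ((paramMeasure r).withDensity fun q => ENNReal.ofReal (paramWidth y q)).map (paramPoint y) =
      volume.restrict (intervalUnion y) := by
  ext s hs
  have hm := (continuous_paramPoint y).measurable
  have hd : Pairwise (Function.onFun Disjoint fun i : Fin r =>
      s ∩ Set.Ioo (leftEnd y i) (rightEnd y i)) := by
    have h : ∀ i j : Fin r, i < j → Disjoint (s ∩ Set.Ioo (leftEnd y i) (rightEnd y i))
        (s ∩ Set.Ioo (leftEnd y j) (rightEnd y j)) := by
      intro i j hij
      refine Set.disjoint_left.2 fun x hx hx' => ?_
      have : rightEnd y i < leftEnd y j := hy (by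
        rw [Fin.lt_def] at hij ⊢
        simp only
        omega)
      linarith [hx.2.2, hx'.2.1]
    intro i j hij
    rcases lt_or_gt_of_ne hij with h' | h'
    · exact h i j h'
    · exact (h j i h').symm
  have hE : s ∩ intervalUnion y = ⋃ i : Fin r, s ∩ Set.Ioo (leftEnd y i) (rightEnd y i) := by
    rw [intervalUnion, Set.inter_iUnion]
    rfl
  rw [Measure.map_apply hm hs, withDensity_apply _ (hm hs), Measure.restrict_apply hs, hE,
    measure_iUnion hd (fun i => hs.inter measurableSet_Ioo), tsum_fintype,
    ← lintegral_indicator (hm hs), paramMeasure, lintegral_prod _ (by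
      refine (Measurable.indicator ?_ (hm hs)).aemeasurable
      exact (continuous_paramWidth y).measurable.ennreal_ofReal), lintegral_count, tsum_fintype]
  refine Finset.sum_congr rfl fun i _ => ?_
  rw [← volume_affine_preimage _ _ (leftEnd_lt_rightEnd hy i) s]
  have hm' : MeasurableSet
      {u : unitInterval | leftEnd y i + u * (rightEnd y i - leftEnd y i) ∈ s} :=
    (hm.comp measurable_prodMk_left) hs
  rw [← lintegral_indicator_const hm']
  rfl

/-- The Jacobian `∏ paramWidth y (x i)` is absorbed by scaling the rows of the matrix. The domain
then no longer depends on `y`, and only the kernel varies. -/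
theorem fredholmDet_intervalUnion {K : ℝ → ℝ → ℝ} (hK : Continuous (Function.uncurry K))
    {y : Fin (2 * r) → ℝ} (hy : StrictMono y) {k : C(IntervalParam r × IntervalParam r, ℝ)}
    (hk : ∀ q q', k (q, q') = paramWidth y q * K (paramPoint y q) (paramPoint y q')) :
    fredholmDet K (intervalUnion y) = fredholmFunctional (paramMeasure r) k := by
  have h0 : ∀ q, 0 ≤ paramWidth y q := fun q => (sub_pos.2 (leftEnd_lt_rightEnd hy q.1)).le
  have hw : Integrable (paramWidth y) (paramMeasure r) :=
    ContinuousMap.integrable_of_compactSpace (paramMeasure r) ⟨_, continuous_paramWidth y⟩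
  unfold fredholmDet fredholmFunctional
  congr 1
  funext n
  congr 1
  have hdet : Continuous fun x : Fin n → ℝ => (Matrix.of fun i j => K (x i) (x j)).det := by
    refine Continuous.matrix_det ?_
    refine continuous_matrix fun i j => ?_
    have h : Continuous fun x : Fin n → ℝ => (x i, x j) := by fun_prop
    exact hK.comp h
  have hfin : IsFiniteMeasure ((paramMeasure r).withDensity
      fun q => ENNReal.ofReal (paramWidth y q)) := isFiniteMeasure_withDensity_ofReal hw.2
  have hm := (continuous_paramPoint y).measurable
  have hm' : Measurable fun (x : Fin n → IntervalParam r) i => paramPoint y (x i) :=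
    measurable_pi_lambda _ fun i => hm.comp (measurable_pi_apply i)
  rw [volume_pi, Measure.restrict_pi_pi, ← map_paramPoint hy,
    ← Measure.pi_map_pi (f := fun _ : Fin n => paramPoint y) fun _ => hm.aemeasurable,
    integral_map hm'.aemeasurable hdet.aestronglyMeasurable,
    pi_withDensity_ofReal _ hw h0, integral_withDensity_eq_integral_toReal_smul]
  · refine integral_congr_ae (Filter.Eventually.of_forall fun x => ?_)
    simp only [hk]
    rw [ENNReal.toReal_ofReal (Finset.prod_nonneg fun i _ => h0 _), smul_eq_mul]
    exact (Matrix.det_mul_column (fun i => paramWidth y (x i))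
      (Matrix.of fun i j => K (paramPoint y (x i)) (paramPoint y (x j)))).symm
  · have := (continuous_paramWidth y).measurable
    fun_prop
  · exact Filter.Eventually.of_forall fun x => ENNReal.ofReal_lt_top

end ChangeOfVariables

/-! ### Smooth dependence of the pulled-back kernel on time and endpoints -/

section SmoothKernel

variable {r : ℕ}

/-- The real part of a complex kernel. -/
noncomputable def kernelRe (Y : Type*) [TopologicalSpace Y] [CompactSpace Y] :
    C(Y, ℂ) →L[ℝ] C(Y, ℝ) :=
  Complex.reCLM.compLeftContinuous ℝ Y

theorem kernelRe_apply {Y : Type*} [TopologicalSpace Y] [CompactSpace Y] (k : C(Y, ℂ)) (q : Y) :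
    kernelRe Y k q = (k q).re := rfl

theorem paramWidth_add (y y' : Fin (2 * r) → ℝ) (q : IntervalParam r) :
    paramWidth (y + y') q = paramWidth y q + paramWidth y' q := by
  simp only [paramWidth, leftEnd, rightEnd, Pi.add_apply]
  ring

theorem paramWidth_smul (c : ℝ) (y : Fin (2 * r) → ℝ) (q : IntervalParam r) :
    paramWidth (c • y) q = c * paramWidth y q := by
  simp only [paramWidth, leftEnd, rightEnd, Pi.smul_apply, smul_eq_mul]
  ring

theorem paramPoint_add (y y' : Fin (2 * r) → ℝ) (q : IntervalParam r) :
    paramPoint (y + y') q = paramPoint y q + paramPoint y' q := by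
  simp only [paramPoint, paramWidth_add, leftEnd, Pi.add_apply]
  ring

theorem paramPoint_smul (c : ℝ) (y : Fin (2 * r) → ℝ) (q : IntervalParam r) :
    paramPoint (c • y) q = c * paramPoint y q := by
  simp only [paramPoint, paramWidth_smul, leftEnd, Pi.smul_apply, smul_eq_mul]
  ring

/-- The parametrization of the intervals, as a linear function of the endpoints, composed with a
map into the parameter space. -/
noncomputable def pointCLM {Y : Type*} [TopologicalSpace Y] [CompactSpace Y]
    (f : C(Y, IntervalParam r)) : (ℝ × (Fin (2 * r) → ℝ)) →L[ℝ] C(Y, ℂ) :=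
  LinearMap.toContinuousLinearMap
    { toFun := fun z => ⟨fun q => (paramPoint z.2 (f q) : ℂ),
        Complex.continuous_ofReal.comp ((continuous_paramPoint z.2).comp f.continuous)⟩
      map_add' := fun z z' => by
        ext q
        simp [paramPoint_add]
      map_smul' := fun c z => by
        ext q
        simp [paramPoint_smul] }

/-- The time, as a linear function with values in the constant kernels. -/
noncomputable def timeCLM (r : ℕ) (Y : Type*) [TopologicalSpace Y] [CompactSpace Y] :
    (ℝ × (Fin (2 * r) → ℝ)) →L[ℝ] C(Y, ℂ) :=
  LinearMap.toContinuousLinearMap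
    { toFun := fun z => ContinuousMap.const Y (z.1 : ℂ)
      map_add' := fun z z' => by
        ext q
        simp
      map_smul' := fun c z => by
        ext q
        simp }

/-- The lengths of the intervals, as a linear function of the endpoints with values in kernels. -/
noncomputable def widthCLM (r : ℕ) :
    (ℝ × (Fin (2 * r) → ℝ)) →L[ℝ] C(IntervalParam r × IntervalParam r, ℝ) :=
  LinearMap.toContinuousLinearMap
    { toFun := fun z => ⟨fun q => paramWidth z.2 q.1,
        (continuous_paramWidth z.2).comp continuous_fst⟩
      map_add' := fun z z' => by
        ext q
        simp [paramWidth_add]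
      map_smul' := fun c z => by
        ext q
        simp [paramWidth_smul] }

/-- The exponent of the Pearcey kernel pulled back to the parameter space. -/
noncomputable def pulledExponent (r : ℕ) : Fin 4 × ℝ × ℝ →
    (ℝ × (Fin (2 * r) → ℝ)) →L[ℝ] C(IntervalParam r × IntervalParam r, ℂ) :=
  contourExponent (algebraMap ℂ C(IntervalParam r × IntervalParam r, ℂ))
    (timeCLM r _) (pointCLM ⟨Prod.fst, continuous_fst⟩) (pointCLM ⟨Prod.snd, continuous_snd⟩)

/-- The Pearcey kernel pulled back to the parameter space, without the Jacobian. -/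
noncomputable def pulledContour (r : ℕ) :
    ℝ × (Fin (2 * r) → ℝ) → C(IntervalParam r × IntervalParam r, ℂ) :=
  expIntegral contourMeasure (pulledExponent r) (fun p => algebraMap ℂ _ (contourWeight p))

/-- The Pearcey kernel pulled back to the parameter space. -/
noncomputable def pulledKernel (r : ℕ) (z : ℝ × (Fin (2 * r) → ℝ)) :
    C(IntervalParam r × IntervalParam r, ℝ) :=
  widthCLM r z * kernelRe _ (pulledContour r z)

section

variable [Nonempty (Fin r)]

/-- Nonemptiness of the parameter space gives `‖1‖ = 1` in the function algebra, so that constants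
embed isometrically. -/
theorem gaugeBounded_pulledExponent :
    GaugeBounded contourMeasure contourGauge (pulledExponent r) :=
  gaugeBounded_contourExponent (fun z => norm_algebraMap' _ z) _ _ _

theorem expIntegrable_pulledWeight : ExpIntegrable contourMeasure contourGauge
    (fun p => algebraMap ℂ C(IntervalParam r × IntervalParam r, ℂ) (contourWeight p)) :=
  expIntegrable_map_contourWeight (fun z => norm_algebraMap' _ z)

theorem contDiff_pulledContour : ContDiff ℝ (⊤ : ℕ∞) (pulledContour r) :=
  expIntegrable_pulledWeight.contDiff gaugeBounded_pulledExponent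

theorem contDiff_pulledKernel : ContDiff ℝ (⊤ : ℕ∞) (pulledKernel r) :=
  (widthCLM r).contDiff.mul
    ((kernelRe (IntervalParam r × IntervalParam r)).contDiff.comp (contDiff_pulledContour (r := r)))

/-- Evaluation at a point is a continuous algebra homomorphism, so it commutes with both the
integral and the exponential. -/
theorem pulledContour_apply (z : ℝ × (Fin (2 * r) → ℝ)) (q q' : IntervalParam r) :
    pulledContour r z (q, q') = pearceyContour z.1 z.1 (paramPoint z.2 q) (paramPoint z.2 q') := by
  have h := (ContinuousMap.evalCLM ℝ (M := ℂ) (q, q')).integral_comp_comm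
    (expIntegrable_pulledWeight.integrable_mul_exp gaugeBounded_pulledExponent z)
  rw [pearceyContour_eq_integral]
  refine h.symm.trans (integral_congr_ae (Filter.Eventually.of_forall fun p => ?_))
  have he : ∀ f : C(IntervalParam r × IntervalParam r, ℂ),
      (NormedSpace.exp f) (q, q') = Complex.exp (f (q, q')) := by
    intro f
    rw [Complex.exp_eq_exp_ℂ]
    let _ : NormedAlgebra ℚ C(IntervalParam r × IntervalParam r, ℂ) :=
      NormedAlgebra.restrictScalars ℚ ℝ _
    exact NormedSpace.map_exp (ContinuousMap.evalAlgHom ℝ ℂ (q, q'))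
      (continuous_eval_const (q, q')) f
  simp only [ContinuousMap.evalCLM_apply, ContinuousMap.mul_apply, he]
  rfl

theorem pulledKernel_apply (z : ℝ × (Fin (2 * r) → ℝ)) (q q' : IntervalParam r) :
    pulledKernel r z (q, q') = paramWidth z.2 q *
      pearceyKernel z.1 z.1 (paramPoint z.2 q) (paramPoint z.2 q') := by
  rw [pearceyKernel_self, ← pulledContour_apply]
  rfl

theorem continuous_pearceyKernel (t : ℝ) :
    Continuous (Function.uncurry (pearceyKernel t t)) := by
  have h := expIntegrable_contourWeight.contDiff
    (gaugeBounded_contourExponent (fun _ => rfl) _ _ _ : GaugeBounded _ _ scalarExponent)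
  have h2 : Function.uncurry (pearceyKernel t t) = fun p : ℝ × ℝ =>
      (expIntegral contourMeasure scalarExponent contourWeight (t, p)).re := by
    funext p
    rw [Function.uncurry, pearceyKernel_self, pearceyContour_eq_integral]
    simp [expIntegral, scalarExponent, contourExponent_apply, ← Complex.exp_eq_exp_ℂ]
  rw [h2]
  have := h.continuous
  fun_prop

theorem pearceyProb_eq {t : ℝ} {y : Fin (2 * r) → ℝ} (hy : StrictMono y) :
    pearceyProb t y = fredholmFunctional (paramMeasure r) (pulledKernel r (t, y)) :=
  fredholmDet_intervalUnion (continuous_pearceyKernel t) hy (pulledKernel_apply (t, y))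

end

end SmoothKernel

/-! ### `∂_E` and `∂_t` as directional derivatives -/

section BoundaryOperators

variable {m : ℕ}

/-- The sum of the partial derivatives is the derivative along `(1, …, 1)`. Agreement of `f` and `g`
is asked only on an open set, since `log ℙ` is identified with its extension only for ordered
endpoints. -/
theorem boundaryDeriv_eq_dirDerivs {f : ℝ → (Fin m → ℝ) → ℝ} {g : ℝ × (Fin m → ℝ) → ℝ}
    {S : Set (ℝ × (Fin m → ℝ))} (hS : IsOpen S) (hg : ContDiffOn ℝ (⊤ : ℕ∞) g S)
    (h : ∀ z ∈ S, f z.1 z.2 = g z) {z : ℝ × (Fin m → ℝ)} (hz : z ∈ S) :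
    boundaryDeriv f z.1 z.2 = dirDerivs [(0, fun _ => 1)] g z := by
  have hd := (hg.differentiableAt_of_isOpen hS hz).hasFDerivAt
  have hi : ∀ i, deriv (fun s => f z.1 (Function.update z.2 i s)) (z.2 i) =
      fderiv ℝ g z (0, Pi.single i 1) := by
    intro i
    have hz' : (z.1, Function.update z.2 i (z.2 i)) = z := by simp
    have hc : HasDerivAt (fun s => (z.1, Function.update z.2 i s)) (0, Pi.single i 1) (z.2 i) :=
      (hasDerivAt_const _ _).prodMk (hasDerivAt_update z.2 i (z.2 i))
    have hmem : ∀ᶠ s in nhds (z.2 i), (z.1, Function.update z.2 i s) ∈ S := by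
      refine hc.continuousAt.eventually_mem (hS.mem_nhds ?_)
      rwa [hz']
    have he : (fun s => f z.1 (Function.update z.2 i s)) =ᶠ[nhds (z.2 i)]
        fun s => g (z.1, Function.update z.2 i s) := by
      filter_upwards [hmem] with s hs using h _ hs
    rw [he.deriv_eq]
    rw [← hz'] at hd
    have := hd.comp_hasDerivAt (z.2 i) hc
    rw [hz'] at this
    exact this.deriv
  rw [boundaryDeriv, Finset.sum_congr rfl fun i _ => hi i, ← map_sum]
  simp only [dirDerivs]
  congr 1
  refine Prod.ext ?_ ?_
  · simp [Prod.fst_sum]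
  · rw [Prod.snd_sum]
    exact Finset.univ_sum_single (fun _ : Fin m => (1 : ℝ))

theorem timeDeriv_eq_dirDerivs {f : ℝ → (Fin m → ℝ) → ℝ} {g : ℝ × (Fin m → ℝ) → ℝ}
    {S : Set (ℝ × (Fin m → ℝ))} (hS : IsOpen S) (hg : ContDiffOn ℝ (⊤ : ℕ∞) g S)
    (h : ∀ z ∈ S, f z.1 z.2 = g z) {z : ℝ × (Fin m → ℝ)} (hz : z ∈ S) :
    timeDeriv f z.1 z.2 = dirDerivs [(1, 0)] g z := by
  have hd := (hg.differentiableAt_of_isOpen hS hz).hasFDerivAt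
  have hc : HasDerivAt (fun s => (s, z.2)) ((1 : ℝ), (0 : Fin m → ℝ)) z.1 :=
    (hasDerivAt_id _).prodMk (hasDerivAt_const _ _)
  have he : (fun s => f s z.2) =ᶠ[nhds z.1] fun s => g (s, z.2) := by
    filter_upwards [hc.continuousAt.eventually_mem (hS.mem_nhds hz)] with s hs using h _ hs
  rw [timeDeriv, he.deriv_eq]
  exact (hd.comp_hasDerivAt z.1 hc).deriv

theorem boundaryDeriv_dirDerivs {f : ℝ → (Fin m → ℝ) → ℝ} {g : ℝ × (Fin m → ℝ) → ℝ}
    {S : Set (ℝ × (Fin m → ℝ))} (hS : IsOpen S) (hg : ContDiffOn ℝ (⊤ : ℕ∞) g S)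
    {l : List (ℝ × (Fin m → ℝ))} (h : ∀ z ∈ S, f z.1 z.2 = dirDerivs l g z) :
    ∀ z ∈ S, boundaryDeriv f z.1 z.2 = dirDerivs ((0, fun _ => 1) :: l) g z := fun _ hz =>
  boundaryDeriv_eq_dirDerivs hS (hg.dirDerivs hS l) h hz

theorem timeDeriv_dirDerivs {f : ℝ → (Fin m → ℝ) → ℝ} {g : ℝ × (Fin m → ℝ) → ℝ}
    {S : Set (ℝ × (Fin m → ℝ))} (hS : IsOpen S) (hg : ContDiffOn ℝ (⊤ : ℕ∞) g S)
    {l : List (ℝ × (Fin m → ℝ))} (h : ∀ z ∈ S, f z.1 z.2 = dirDerivs l g z) :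
    ∀ z ∈ S, timeDeriv f z.1 z.2 = dirDerivs ((1, 0) :: l) g z := fun _ hz =>
  timeDeriv_eq_dirDerivs hS (hg.dirDerivs hS l) h hz

theorem isOpen_strictMono_snd :
    IsOpen {z : ℝ × (Fin m → ℝ) | StrictMono z.2} := by
  have : {z : ℝ × (Fin m → ℝ) | StrictMono z.2} =
      ⋂ i : Fin m, ⋂ j : Fin m, ⋂ _ : i < j, {z : ℝ × (Fin m → ℝ) | z.2 i < z.2 j} := by
    ext z
    simp only [Set.mem_iInter]
    exact ⟨fun h i j hij => h hij, fun h i j hij => h i j hij⟩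
  rw [this]
  refine isOpen_iInter_of_finite fun i => isOpen_iInter_of_finite fun j =>
    isOpen_iInter_of_finite fun _ => isOpen_lt (by fun_prop) (by fun_prop)

end BoundaryOperators

/-! ### First-order expansion of `log ℙ` at collapsed endpoints -/

section Expansion

variable {r : ℕ}

/-- The smooth extension of `log ℙ` to all `(t,y)` near the origin. -/
noncomputable def logExtension (r : ℕ) (z : ℝ × (Fin (2 * r) → ℝ)) : ℝ :=
  Real.log (fredholmFunctional (paramMeasure r) (pulledKernel r z))

/-- The map `(t,h) ↦ (t,(h,…,h))`. -/
noncomputable def diagonalCLM (r : ℕ) : (ℝ × ℝ) →L[ℝ] ℝ × (Fin (2 * r) → ℝ) :=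
  (ContinuousLinearMap.fst ℝ ℝ ℝ).prod
    (ContinuousLinearMap.pi fun _ => ContinuousLinearMap.snd ℝ ℝ ℝ)

theorem diagonalCLM_apply (z : ℝ × ℝ) : diagonalCLM r z = (z.1, fun _ => z.2) := rfl

theorem widthCLM_diagonal (z : ℝ × ℝ) : widthCLM r (diagonalCLM r z) = 0 := by
  ext q
  exact sub_self _

theorem pulledKernel_diagonal (z : ℝ × ℝ) : pulledKernel r (diagonalCLM r z) = 0 := by
  rw [pulledKernel, widthCLM_diagonal, zero_mul]

theorem pulledKernel_zero : pulledKernel r 0 = 0 := by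
  rw [pulledKernel, map_zero, zero_mul]

/-- Equally spaced endpoints. -/
noncomputable def equalSpacing (r : ℕ) : ℝ × (Fin (2 * r) → ℝ) := (0, fun i => (i.val : ℝ))

theorem widthCLM_equalSpacing : widthCLM r (equalSpacing r) = 1 := by
  ext q
  change ((2 * q.1.1.val + 1 : ℕ) : ℝ) - ((2 * q.1.1.val : ℕ) : ℝ) = 1
  push_cast
  ring

theorem paramMeasure_real_univ : (paramMeasure r).real Set.univ = r := by
  have : (Set.univ : Set (IntervalParam r)) = Set.univ ×ˢ Set.univ := Set.univ_prod_univ.symm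
  rw [Measure.real, paramMeasure, this, Measure.prod_prod]
  simp

theorem logExtension_diagonal (z : ℝ × ℝ) : logExtension r (diagonalCLM r z) = 0 := by
  rw [logExtension, pulledKernel_diagonal, fredholmFunctional_zero, Real.log_one]

variable [Nonempty (Fin r)]

theorem exists_isOpen_contDiffOn_logExtension :
    ∃ U : Set (ℝ × (Fin (2 * r) → ℝ)), IsOpen U ∧ 0 ∈ U ∧
      ContDiffOn ℝ (⊤ : ℕ∞) (logExtension r) U ∧
      ∀ z ∈ U, 0 < fredholmFunctional (paramMeasure r) (pulledKernel r z) := by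
  have hk : Filter.Tendsto (pulledKernel r) (nhds 0) (nhds 0) := by
    have := (contDiff_pulledKernel (r := r)).continuous.tendsto 0
    rwa [pulledKernel_zero] at this
  have h1 := hk.eventually (contDiffAt_fredholmFunctional (paramMeasure r))
  have h2 : ∀ᶠ k in nhds 0, 0 < fredholmFunctional (paramMeasure r) k := by
    have hc : ContinuousAt (fredholmFunctional (paramMeasure r)) 0 :=
      (contDiffAt_fredholmFunctional (paramMeasure r)).self_of_nhds.continuousAt
    refine hc.eventually_const_lt ?_
    rw [fredholmFunctional_zero]
    exact one_pos
  obtain ⟨U, hU, hUo, h0⟩ := eventually_nhds_iff.1 (h1.and (hk.eventually h2))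
  refine ⟨U, hUo, h0, fun z hz => ?_, fun z hz => (hU z hz).2⟩
  obtain ⟨hz1, hz2⟩ := hU z hz
  exact ((hz1.comp z contDiff_pulledKernel.contDiffAt).log hz2.ne').contDiffWithinAt

/-- On the diagonal the widths vanish, so the product rule leaves only the derivative of the widths,
equal to `1`, times the contour kernel. The determinant contributes minus the trace and the
logarithm at `1` a factor `1`; the trace is the constant `ρ(t, h)` times the total mass `r`. -/
theorem fderiv_logExtension_diagonal (z : ℝ × ℝ) :
    fderiv ℝ (logExtension r) (diagonalCLM r z) (equalSpacing r) =
      -(r : ℝ) * pearceyDensity z := by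
  have hC : DifferentiableAt ℝ (fun x => kernelRe (IntervalParam r × IntervalParam r)
      (pulledContour r x)) (diagonalCLM r z) :=
    ((kernelRe (IntervalParam r × IntervalParam r)).contDiff.comp
      (contDiff_pulledContour (r := r))).differentiable (by simp) _
  have hk : HasFDerivAt (pulledKernel r) _ (diagonalCLM r z) :=
    (widthCLM r).hasFDerivAt.mul hC.hasFDerivAt
  have hΦ : HasFDerivAt (fredholmFunctional (paramMeasure r))
      (fderiv ℝ (fredholmFunctional (paramMeasure r)) 0) (pulledKernel r (diagonalCLM r z)) := by
    rw [pulledKernel_diagonal]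
    exact ((contDiffAt_fredholmFunctional
      (paramMeasure r)).self_of_nhds.differentiableAt (by simp)).hasFDerivAt
  have hF := hΦ.comp _ hk
  have hne : (fredholmFunctional (paramMeasure r) ∘ pulledKernel r) (diagonalCLM r z) ≠ 0 := by
    rw [Function.comp_apply, pulledKernel_diagonal, fredholmFunctional_zero]
    exact one_ne_zero
  have hL := hF.log hne
  have hL' : fderiv ℝ (logExtension r) (diagonalCLM r z) = _ := hL.fderiv
  rw [hL', Function.comp_apply, pulledKernel_diagonal, fredholmFunctional_zero]
  simp only [inv_one, one_smul, ContinuousLinearMap.comp_apply, smul_apply,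
    widthCLM_diagonal, widthCLM_equalSpacing, zero_smul, zero_add,
    smul_eq_mul, mul_one, fderiv_fredholmFunctional_zero]
  have hv : ∀ q : IntervalParam r,
      kernelRe (IntervalParam r × IntervalParam r) (pulledContour r (diagonalCLM r z)) (q, q) =
        pearceyDensity z := by
    intro q
    have hp : paramPoint (fun _ : Fin (2 * r) => z.2) q = z.2 := by
      simp [paramPoint, paramWidth, leftEnd, rightEnd]
    rw [kernelRe_apply, pulledContour_apply, diagonalCLM_apply, hp, pearceyDensity,
      pearceyKernel_self]
  simp only [hv, integral_const, paramMeasure_real_univ, smul_eq_mul]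
  ring

end Expansion

/-! ### Nonvanishing of the Wronskian -/

/-- Each function is `ε c + o(ε)`, so the expression divided by `ε²` tends to `c₁ c₂ - c₃ c₄`. -/
theorem exists_pos_wronskian_ne_zero {g₁ g₂ g₃ g₄ : ℝ → ℝ} {c₁ c₂ c₃ c₄ : ℝ}
    (h₁ : HasDerivAt g₁ c₁ 0) (h₂ : HasDerivAt g₂ c₂ 0) (h₃ : HasDerivAt g₃ c₃ 0)
    (h₄ : HasDerivAt g₄ c₄ 0) (z₁ : g₁ 0 = 0) (z₂ : g₂ 0 = 0) (z₃ : g₃ 0 = 0) (z₄ : g₄ 0 = 0)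
    (hc : c₁ * c₂ - c₃ * c₄ ≠ 0) :
    ∀ᶠ ε in nhdsWithin (0 : ℝ) (Set.Ioi 0), g₁ ε * g₂ ε - g₃ ε * g₄ ε ≠ 0 := by
  have key : ∀ {g : ℝ → ℝ} {c : ℝ}, HasDerivAt g c 0 → g 0 = 0 →
      Filter.Tendsto (fun ε => ε⁻¹ * g ε) (nhdsWithin (0 : ℝ) (Set.Ioi 0)) (nhds c) := by
    intro g c h z
    simpa [z] using h.tendsto_slope_zero_right
  have h := ((key h₁ z₁).mul (key h₂ z₂)).sub ((key h₃ z₃).mul (key h₄ z₄))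
  filter_upwards [h.eventually_ne hc] with ε hε h0
  refine hε ?_
  linear_combination ε⁻¹ * ε⁻¹ * h0

/-- For every number `r ≥ 1` of intervals, the Wronskian
`{∂_t ∂_E² log ℙ, ∂_E³ log ℙ}_{∂_E}` is not the zero function: it is nonzero at some time `t` and
some boundary points `y₁ < ⋯ < y_{2r}` where `ℙ > 0` and near which `log ℙ` is four times
continuously differentiable, so that all derivatives in it are genuine. -/
theorem proposition6p1 (r : ℕ) (hr : 1 ≤ r) :
    ∃ (t : ℝ) (y : Fin (2 * r) → ℝ), StrictMono y ∧ 0 < pearceyProb t y ∧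
      ContDiffAt ℝ 4 (fun z : ℝ × (Fin (2 * r) → ℝ) => logPearcey r z.1 z.2) (t, y) ∧
      boundaryWronskian (timeDeriv (boundaryDeriv^[2] (logPearcey r)))
        (boundaryDeriv^[3] (logPearcey r)) t y ≠ 0 := by
  have : Nonempty (Fin r) := ⟨⟨0, hr⟩⟩
  obtain ⟨U, hU, h0, hL, hpos⟩ := exists_isOpen_contDiffOn_logExtension (r := r)
  set S : Set (ℝ × (Fin (2 * r) → ℝ)) := U ∩ {z | StrictMono z.2} with hSdef
  have hS : IsOpen S := hU.inter isOpen_strictMono_snd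
  have hLS : ContDiffOn ℝ (⊤ : ℕ∞) (logExtension r) S := hL.mono Set.inter_subset_left
  have heq : ∀ z ∈ S, logPearcey r z.1 z.2 = dirDerivs [] (logExtension r) z := fun z hz => by
    rw [logPearcey, pearceyProb_eq hz.2]
    rfl
  have hD2 := boundaryDeriv_dirDerivs hS hLS (boundaryDeriv_dirDerivs hS hLS heq)
  have hD3 := boundaryDeriv_dirDerivs hS hLS hD2
  have hD4 := boundaryDeriv_dirDerivs hS hLS hD3
  have hT := timeDeriv_dirDerivs hS hLS hD2
  have hDT := boundaryDeriv_dirDerivs hS hLS hT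
  have hg : ∀ z, diagonalCLM r z ∈ U → fderiv ℝ (logExtension r) (diagonalCLM r z)
      (equalSpacing r) = (-(r : ℝ) • ContinuousLinearMap.id ℝ ℝ) (pearceyDensity z) :=
    fun z _ => by rw [fderiv_logExtension_diagonal]; rfl
  have hder := hasDerivAt_dirDerivs_smul hU hL h0 (diagonalCLM r) (equalSpacing r) hg
  have hzero := dirDerivs_eq_zero_of_comp hU hL h0 (diagonalCLM r)
    fun z _ => logExtension_diagonal z
  have hcomp : ∀ l : List (ℝ × ℝ), dirDerivs l (fun z =>
      (-(r : ℝ) • ContinuousLinearMap.id ℝ ℝ) (pearceyDensity z)) 0 =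
      -(r : ℝ) * dirDerivs l pearceyDensity 0 := fun l =>
    dirDerivs_clm_comp isOpen_univ contDiff_pearceyDensity.contDiffOn
      (-(r : ℝ) • ContinuousLinearMap.id ℝ ℝ) l (Set.mem_univ _)
  simp only [hcomp] at hder
  have hM := contourMoment_one_two_pos
  have hr' : (0 : ℝ) < r := by exact_mod_cast hr
  have hW := exists_pos_wronskian_ne_zero
    -- The mixed derivative `ρ_thhh` never has to be computed: it is multiplied by `ρ_hhh = 0`.
    (hder [(0, 1), (0, 1), (0, 1)]) (hder [(0, 1), (1, 0), (0, 1), (0, 1)])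
    (hder [(1, 0), (0, 1), (0, 1)]) (hder [(0, 1), (0, 1), (0, 1), (0, 1)])
    (by rw [zero_smul]; exact hzero _) (by rw [zero_smul]; exact hzero _)
    (by rw [zero_smul]; exact hzero _) (by rw [zero_smul]; exact hzero _)
    -- With `M = (contourMoment 1 2).re` the limit coefficient is `-(rM/2)(3rM) = -(3/2) r² M²`.
    (by
      rw [dirDerivs_pearceyDensity_space_three, dirDerivs_pearceyDensity_space_four,
        dirDerivs_pearceyDensity_time]
      have : 0 < (r : ℝ) ^ 2 * (contourMoment 1 2).re ^ 2 := by positivity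
      nlinarith)
  have hmem : ∀ᶠ ε in nhdsWithin (0 : ℝ) (Set.Ioi 0), ε • equalSpacing r ∈ U := by
    have hc : ContinuousAt (fun ε : ℝ => ε • equalSpacing r) 0 := by fun_prop
    refine (hc.eventually_mem (hU.mem_nhds ?_)).filter_mono nhdsWithin_le_nhds
    simpa using h0
  obtain ⟨ε, ⟨hεW, hεU⟩, hε⟩ := ((hW.and hmem).and self_mem_nhdsWithin).exists
  have hε : 0 < ε := hε
  have hmono : StrictMono (ε • equalSpacing r).2 := fun i j hij =>
    mul_lt_mul_of_pos_left (Nat.cast_lt.2 hij) hε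
  have hmS : ε • equalSpacing r ∈ S := ⟨hεU, hmono⟩
  refine ⟨(ε • equalSpacing r).1, (ε • equalSpacing r).2, hmono, ?_, ?_, ?_⟩
  · rw [pearceyProb_eq hmono]
    exact hpos _ hεU
  · have h4 : ContDiffAt ℝ 4 (logExtension r) (ε • equalSpacing r) :=
      (hLS.contDiffAt (hS.mem_nhds hmS)).of_le
        (WithTop.coe_le_coe.2 (le_top : (4 : ℕ∞) ≤ ⊤))
    refine h4.congr_of_eventuallyEq ?_
    filter_upwards [hS.mem_nhds hmS] with z hz using heq z hz
  · have e1 := hDT _ hmS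
    have e2 := hD3 _ hmS
    have e3 := hT _ hmS
    have e4 := hD4 _ hmS
    rw [boundaryWronskian]
    simp only [Function.iterate_succ, Function.iterate_zero, Function.comp_apply, id]
    rw [e1, e2, e3, e4]
    exact hεW
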